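/- **Setting.** Let $\mathcal W\subseteq\mathbb R^d$ be bounded, closed and convex, $m\ge 1$, $f:\mathcal W\to\mathbb R$ $\lambda$-strongly convex ($\lambda>0$) and $L_f$-Lipschitz, and $g_1,\dots,g_m:\mathcal W\to\mathbb R$ convex and $L_g$-Lipschitz ($L_g>0$), all with respect to $\|\cdot\|_2$. Put $g=\max_i g_i$, and let $\partial$ denote the subdifferential relative to $\mathcal W$. Assume that there is $\rho>0$ with $\|v\|_2\ge\rho$ whenever $w\in\mathcal W$, $g(w)=0$ and $v\in\partial g(w)$, and let $\gamma>0$ satisfy $\gamma>L_f/\rho$. Let $w^*$ be the minimizer of $f$ on $\{w\in\mathcal W: g_i(w)\le 0\ \forall i\}$ (assumed nonempty), let $\Pi_g$ and $\Pi_w$ be the Euclidean projections onto this set and onto $\mathcal W$, and write $\check\nabla\max\{0,g_i\}(w)$ for a (measurable) choice of a subgradient of $\max\{0,g_i\}$ at $w$. **Algorithm (MidTouch)**, with parameters $T_1,T_2\ge 1$ and $\eta=\lambda/(2\gamma^2L_g^2)$. Start from an arbitrary $w^{(1)}\in\mathcal W$. In every iteration $t$ a stochastic subgradient $\check\Delta^{(t)}$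 of $f$ is drawn: given the past, its conditional expectation lies in $\partial f(w^{(t)})$, and $\|\check\Delta^{(t)}\|_2\le G_f$ almost surely. *First phase*, $t=1,\dots,T_1$: evaluate all constraints at $w^{(t)}$, let $i$ be the index of a largest value, and set $w^{(t+1)}=\Pi_w\big(w^{(t)}-\tfrac1{\lambda t}(\check\Delta^{(t)}+\gamma\check\nabla\max\{0,g_i\}(w^{(t)}))\big)$. Then redefine $w^{(T_1+1)}=\frac1{T_1}\sum_{t=1}^{T_1}w^{(t)}$, let $p^{(T_1+1)}$ be the uniform distribution on $\{1,\dots,m\}$, and let $\mu_k^{(T_1+1)}=\max\{0,g_k(w^{(T_1+1)})\}$ for all $k$. *Second phase*, $t=T_1+1,\dots,T_1+T_2$: draw $i^{(t)}\sim p^{(t)}$ and $j^{(t)}$ uniformly from $\{1,\dots,m\}$ (given the past), and set, with $j=j^{(t)}$, $y=\max\{0,g_j(w^{(t)})\}$ and $\hat\Delta_p^{(t)}=\gamma\mu^{(t)}+\gamma m\,e_j(y-\mu^{(t)}_j)$, $$w^{(t+1)}=\Pi_w\Big(w^{(t)}-\tfrac1{\lambda t}\big(\check\Delta^{(t)}+\gamma\check\nabla\max\{0,g_{i^{(t)}}\}(w^{(t)})\big)\Big),\qquad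 p^{(t+1)}_k\propto p^{(t)}_k\exp\big(\eta\,\hat\Delta^{(t)}_{p,k}\big),$$ $\mu^{(t+1)}_j=y$ and $\mu^{(t+1)}_k=\mu^{(t)}_k$ for $k\ne j$. The result is $\bar w=\frac1{T_2}\sum_{t=T_1+1}^{T_1+T_2}w^{(t)}$, or its projection $\Pi_g(\bar w)$. A *constraint check* is one evaluation or one differentiation of a single $g_i$ (the final projection is not counted). Let $G_g$ be a bound for $\|\check\nabla\max\{0,g_i\}(w)\|_2$ over all $i$ and all $w\in\mathcal W$. **Theorem.** There are absolute constants $C>0$ and $a\in\mathbb N$ such that for all $m\ge1$, $\gamma,\lambda,L_g,\epsilon>0$ and $G_f,G_g\ge0$, with $$\Lambda=1+\ln\Big(1+\frac{(G_f+\gamma G_g+\gamma L_g)^2}{\lambda^2\epsilon}\Big),\qquad \ell=1+\ln m,$$ there are iteration counts $T_{\epsilon1},T_{\epsilon2}\ge1$, depending only on $m,\gamma,\lambda,L_g,G_f,G_g,\epsilon$, with $$T_{\epsilon1}\le C\Lambda^a\Big(1+\frac{m\,\ell^{2/3}(G_f+\gamma G_g+\gamma L_g)^{4/3}}{\lambda^{4/3}\epsilon^{2/3}}+\frac{m^2\,\ell\,(G_f+\gamma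 G_g)}{\lambda\sqrt\epsilon}\Big),$$ $$T_{\epsilon2}\le C\Lambda^a\Big(1+\frac{\ell\,(G_f+\gamma G_g+\gamma L_g)^2}{\lambda^2\epsilon}+\frac{m^{3/2}\ell^{3/2}(G_f+\gamma G_g)^{3/2}}{\lambda^{3/2}\epsilon^{3/4}}\Big),$$ such that, for every problem as above with these parameters, running MidTouch with $T_1=T_{\epsilon1}$ and $T_2=T_{\epsilon2}$ makes a total number of constraint checks of at most $$C\Lambda^a\Big(m+\frac{\ell\,(G_f+\gamma G_g+\gamma L_g)^2}{\lambda^2\epsilon}+\frac{m^{3/2}\ell^{3/2}(G_f+\gamma G_g)^{3/2}}{\lambda^{3/2}\epsilon^{3/4}}+\frac{m^2\ell^{2/3}(G_f+\gamma G_g+\gamma L_g)^{4/3}}{\lambda^{4/3}\epsilon^{2/3}}+\frac{m^3\,\ell\,(G_f+\gamma G_g)}{\lambda\sqrt\epsilon}\Big),$$ and $\|\Pi_g(\bar w)-w^*\|_2^2$ and $\|\bar w-w^*\|_2^2$ are integrable with $$\mathbb E\big[\|\Pi_g(\bar w)-w^*\|_2^2\big]\le\mathbb E\big[\|\bar w-w^*\|_2^2\big]\le\epsilon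 .$$ -/

import Mathlib

open MeasureTheory

noncomputable section

namespace MidTouch

/-- Euclidean space of dimension `d`. -/
abbrev Vec (d : ℕ) : Type := EuclideanSpace ℝ (Fin d)

/-- `v ∈ ∂φ(x)` for a function `φ` on the domain `W`. -/
def IsSubgradient {d : ℕ} (W : Set (Vec d)) (φ : Vec d → ℝ) (x v : Vec d) : Prop :=
  ∀ y ∈ W, φ x + inner ℝ v (y - x) ≤ φ y

/-- Euclidean projection onto `S`: a point of `S` nearest to `x`
(it exists and is unique if `S` is nonempty, closed and convex). -/
def proj {d : ℕ} (S : Set (Vec d)) (x : Vec d) : Vec d :=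
  Classical.epsilon fun y => y ∈ S ∧ ∀ z ∈ S, ‖x - y‖ ≤ ‖x - z‖

/-! ### The constrained problem -/

/-- The problem of minimizing `f` over `W` subject to `g i w ≤ 0` for the `m` indices `i`.
Only the values of `f` and `g i` on `W` matter. -/
structure Problem (d m : ℕ) where
  /-- the domain -/
  W : Set (Vec d)
  /-- the objective -/
  f : Vec d → ℝ
  /-- the constraint functions -/
  g : Fin m → Vec d → ℝ

/-- The combined constraint function `w ↦ max_i g_i(w)`. -/
def Problem.gmax {d m : ℕ} (P : Problem d m) (w : Vec d) : ℝ := ⨆ i, P.g i w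

/-- The feasible set. -/
def Problem.feasible {d m : ℕ} (P : Problem d m) : Set (Vec d) :=
  {w | w ∈ P.W ∧ ∀ i, P.g i w ≤ 0}

/-- `w` minimizes the objective over the feasible set. -/
def Problem.IsOptimum {d m : ℕ} (P : Problem d m) (w : Vec d) : Prop :=
  w ∈ P.feasible ∧ ∀ u ∈ P.feasible, P.f w ≤ P.f u

/-- The standing assumptions: a bounded closed convex domain, a `lam`-strongly convex and
`Lf`-Lipschitz objective, convex and `Lg`-Lipschitz constraints, and subgradients of norm at
least `rho > 0` of the combined constraint wherever that constraint vanishes. -/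
structure Problem.Admissible {d m : ℕ} (P : Problem d m) (lam Lf Lg rho : ℝ) : Prop where
  bounded : Bornology.IsBounded P.W
  closed : IsClosed P.W
  convex : Convex ℝ P.W
  strongConvex : StrongConvexOn P.W lam P.f
  lipschitz_f : ∀ w ∈ P.W, ∀ w' ∈ P.W, |P.f w - P.f w'| ≤ Lf * ‖w - w'‖
  convex_g : ∀ i, ConvexOn ℝ P.W (P.g i)
  lipschitz_g : ∀ i, ∀ w ∈ P.W, ∀ w' ∈ P.W, |P.g i w - P.g i w'| ≤ Lg * ‖w - w'‖
  rho_pos : 0 < rho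
  boundary : ∀ w ∈ P.W, P.gmax w = 0 → ∀ v, IsSubgradient P.W P.gmax w v → rho ≤ ‖v‖

/-- How the algorithm differentiates constraints: `grad i w` is the subgradient of `max{0, g_i}`
used at `w`, and `sel` picks the index of a largest entry of a vector of constraint values. -/
structure Oracle (d m : ℕ) where
  /-- the subgradients of the positive parts of the constraints -/
  grad : Fin m → Vec d → Vec d
  /-- the rule that selects a most violated constraint -/
  sel : (Fin m → ℝ) → Fin m

/-- The oracle answers correctly, and `Gg` bounds the norms of its subgradients. -/
structure Oracle.Valid {d m : ℕ} (O : Oracle d m) (P : Problem d m) (Gg : ℝ) : Prop where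
  subgradient : ∀ i, ∀ w ∈ P.W, IsSubgradient P.W (fun u => max 0 (P.g i u)) w (O.grad i w)
  norm_le : ∀ i, ∀ w ∈ P.W, ‖O.grad i w‖ ≤ Gg
  measurable_grad : ∀ i, Measurable (O.grad i)
  sel_max : ∀ (x : Fin m → ℝ) (i : Fin m), x i ≤ x (O.sel x)
  measurable_sel : Measurable O.sel

/-! ### Computations that count constraint checks -/

/-- A value together with the number of constraint checks spent on computing it. -/
structure Counted (α : Type) where
  /-- the result -/
  val : α
  /-- the number of constraint checks -/
  checks : ℕ

instance : Monad Counted where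
  pure a := ⟨a, 0⟩
  bind c k := ⟨(k c.val).val, c.checks + (k c.val).checks⟩

/-- Perform one computation for each index. -/
def Counted.all {m : ℕ} {α : Type} (c : Fin m → Counted α) : Counted (Fin m → α) :=
  ⟨fun i => (c i).val, ∑ i, (c i).checks⟩

/-- Evaluating one constraint is one check. -/
def evalConstraint {d m : ℕ} (P : Problem d m) (i : Fin m) (w : Vec d) : Counted ℝ :=
  ⟨P.g i w, 1⟩

/-- Differentiating one constraint is one check. -/
def diffConstraint {d m : ℕ} (O : Oracle d m) (i : Fin m) (w : Vec d) : Counted (Vec d) :=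
  ⟨O.grad i w, 1⟩

/-! ### The algorithm -/

/-- The hyperparameters: constraint scaling, strong convexity constant (which sets the steps
`1 / (lam * t)` of the `w`-update), step size of the `p`-update, and the lengths of the phases. -/
structure Hyper where
  /-- constraint scaling factor -/
  γ : ℝ
  /-- strong convexity constant -/
  lam : ℝ
  /-- step size of the `p`-update -/
  η : ℝ
  /-- number of iterations in the first phase -/
  T₁ : ℕ
  /-- number of iterations in the second phase -/
  T₂ : ℕ

/-- Everything drawn from outside by one execution: the initial point and, for each iteration
`t = 1, 2, …`, the stochastic subgradient of `f` and (in the second phase only) the indices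
`i^(t)` and `j^(t)`. -/
structure Draws (d m : ℕ) where
  /-- initial point -/
  w₁ : Vec d
  /-- stochastic subgradients of the objective -/
  sg : ℕ → Vec d
  /-- index of the constraint used in the `w`-update -/
  i : ℕ → Fin m
  /-- index of the constraint used in the `p`-update -/
  j : ℕ → Fin m

section Algorithm

variable {d m : ℕ} (P : Problem d m) (O : Oracle d m) (H : Hyper) (D : Draws d m)

/-- The projected step of iteration `t` from `w`, with `v` a subgradient of the positive part
of a constraint. -/
def wUpdate (t : ℕ) (w v : Vec d) : Vec d :=
  proj P.W (w - (1 / (H.lam * t)) • (D.sg t + H.γ • v))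

/-- `firstPhase n` computes `w^(n+1)`: in each iteration all constraints are evaluated, and one
with the largest value is differentiated. -/
def firstPhase : ℕ → Counted (Vec d)
  | 0 => pure D.w₁
  | n + 1 => do
    let w ← firstPhase n
    let x ← Counted.all fun i => evalConstraint P i w
    let v ← diffConstraint O (O.sel x) w
    return wUpdate P H D (n + 1) w v

/-- The average of the iterates `w^(1), …, w^(T₁)` of the first phase. -/
def firstAverage : Vec d :=
  (1 / (H.T₁ : ℝ)) • ∑ n ∈ Finset.range H.T₁, (firstPhase P O H D n).val

/-- The state of the second phase: the iterate `w`, the distribution `p` on the constraints, and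
the remembered positive parts `mu` of the constraint values. -/
structure State (d m : ℕ) where
  /-- current iterate -/
  w : Vec d
  /-- current distribution on the constraint indices -/
  p : Fin m → ℝ
  /-- remembered values -/
  mu : Fin m → ℝ

/-- The stochastic supergradient
`γ μ + γ m e_j (y - μ_j)`, where `y` is the current value of `max{0, g_j}`. -/
def pGradient (mu : Fin m → ℝ) (j : Fin m) (y : ℝ) : Fin m → ℝ :=
  fun k => H.γ * mu k + if k = j then H.γ * m * (y - mu j) else 0

/-- The multiplicative update along `s`, followed by normalization in the `1`-norm. -/
def pUpdate (p s : Fin m → ℝ) : Fin m → ℝ :=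
  let q : Fin m → ℝ := fun k => Real.exp (Real.log (p k) + H.η * s k)
  fun k => q k / ∑ l, |q l|

/-- Iteration `t` of the second phase. -/
def secondStep (t : ℕ) (s : State d m) : Counted (State d m) := do
  let v ← diffConstraint O (D.i t) s.w
  let x ← evalConstraint P (D.j t) s.w
  return {
    w := wUpdate P H D t s.w v
    p := pUpdate H s.p (pGradient H s.mu (D.j t) (max 0 x))
    mu := Function.update s.mu (D.j t) (max 0 x) }

/-- `secondPhase n` computes the state at the beginning of iteration `T₁ + n + 1`. The checks
made in the first phase and in the initialization are included in the count. -/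
def secondPhase : ℕ → Counted (State d m)
  | 0 => do
    let _ ← firstPhase P O H D H.T₁
    let w := firstAverage P O H D
    let x ← Counted.all fun k => evalConstraint P k w
    return { w := w, p := fun _ => 1 / (m : ℝ), mu := fun k => max 0 (x k) }
  | n + 1 => do
    let s ← secondPhase n
    secondStep P O H D (H.T₁ + n + 1) s

/-- The result `w̄`: the average of the second-phase iterates `w^(T₁+1), …, w^(T₁+T₂)`. -/
def average : Vec d :=
  (1 / (H.T₂ : ℝ)) • ∑ n ∈ Finset.range H.T₂, (secondPhase P O H D n).val.w

/-- The number of constraint checks made by the whole execution (the single final projection onto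
the feasible set is not a constraint check). -/
def totalChecks : ℕ := (secondPhase P O H D H.T₂).checks

end Algorithm

/-- The random draws `D` on the probability space `(Ω, μ)` follow the sampling rules of the
algorithm: given the past `F (t - 1)` of iteration `t`, the stochastic subgradient has a
conditional expectation in `∂f(w^(t))` and is bounded in norm by `Gf`; in the second phase moreover
`i^(t)` has conditional distribution `p^(t)` and `j^(t)` is uniform. The draws of iteration `t` are
known at time `t`. -/
structure IsRun {d m : ℕ} {Ω : Type*} {mΩ : MeasurableSpace Ω} (μ : Measure Ω)
    (F : Filtration ℕ mΩ) (P : Problem d m) (O : Oracle d m) (H : Hyper) (Gf : ℝ)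
    (D : Ω → Draws d m) : Prop where
  init_mem : ∀ ω, (D ω).w₁ ∈ P.W
  init_meas : Measurable[F 0] fun ω => (D ω).w₁
  sg_meas : ∀ t, 1 ≤ t → t ≤ H.T₁ + H.T₂ → Measurable[F t] fun ω => (D ω).sg t
  i_meas : ∀ t, H.T₁ + 1 ≤ t → t ≤ H.T₁ + H.T₂ → Measurable[F t] fun ω => (D ω).i t
  j_meas : ∀ t, H.T₁ + 1 ≤ t → t ≤ H.T₁ + H.T₂ → Measurable[F t] fun ω => (D ω).j t
  sg_bound : ∀ t, 1 ≤ t → t ≤ H.T₁ + H.T₂ → ∀ᵐ ω ∂μ, ‖(D ω).sg t‖ ≤ Gf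
  sg_first : ∀ n < H.T₁, ∀ᵐ ω ∂μ,
    IsSubgradient P.W P.f (firstPhase P O H (D ω) n).val
      ((μ[fun ω' => (D ω').sg (n + 1) | F n]) ω)
  sg_second : ∀ n < H.T₂, ∀ᵐ ω ∂μ,
    IsSubgradient P.W P.f (secondPhase P O H (D ω) n).val.w
      ((μ[fun ω' => (D ω').sg (H.T₁ + n + 1) | F (H.T₁ + n)]) ω)
  i_law : ∀ n < H.T₂, ∀ k : Fin m, ∀ᵐ ω ∂μ,
    (μ[fun ω' => if (D ω').i (H.T₁ + n + 1) = k then (1 : ℝ) else 0 | F (H.T₁ + n)]) ω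
      = (secondPhase P O H (D ω) n).val.p k
  j_law : ∀ n < H.T₂, ∀ k : Fin m, ∀ᵐ ω ∂μ,
    (μ[fun ω' => if (D ω').j (H.T₁ + n + 1) = k then (1 : ℝ) else 0 | F (H.T₁ + n)]) ω
      = 1 / (m : ℝ)

/-! ### The rates -/

/-- The rate for the number of first-phase iterations. -/
def rate₁ (m : ℕ) (γ lam Lg Gf Gg ε : ℝ) : ℝ :=
  m * (1 + Real.log m) ^ (2 / 3 : ℝ) * (Gf + γ * Gg + γ * Lg) ^ (4 / 3 : ℝ)
      / (lam ^ (4 / 3 : ℝ) * ε ^ (2 / 3 : ℝ))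
    + (m : ℝ) ^ 2 * (1 + Real.log m) * (Gf + γ * Gg) / (lam * √ε)

/-- The rate for the number of second-phase iterations. -/
def rate₂ (m : ℕ) (γ lam Lg Gf Gg ε : ℝ) : ℝ :=
  (1 + Real.log m) * (Gf + γ * Gg + γ * Lg) ^ 2 / (lam ^ 2 * ε)
    + (m : ℝ) ^ (3 / 2 : ℝ) * (1 + Real.log m) ^ (3 / 2 : ℝ) * (Gf + γ * Gg) ^ (3 / 2 : ℝ)
      / (lam ^ (3 / 2 : ℝ) * ε ^ (3 / 4 : ℝ))

/-- The rate for the number of constraint checks. -/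
def checkRate (m : ℕ) (γ lam Lg Gf Gg ε : ℝ) : ℝ :=
  (1 + Real.log m) * (Gf + γ * Gg + γ * Lg) ^ 2 / (lam ^ 2 * ε)
    + (m : ℝ) ^ (3 / 2 : ℝ) * (1 + Real.log m) ^ (3 / 2 : ℝ) * (Gf + γ * Gg) ^ (3 / 2 : ℝ)
      / (lam ^ (3 / 2 : ℝ) * ε ^ (3 / 4 : ℝ))
    + (m : ℝ) ^ 2 * (1 + Real.log m) ^ (2 / 3 : ℝ) * (Gf + γ * Gg + γ * Lg) ^ (4 / 3 : ℝ)
      / (lam ^ (4 / 3 : ℝ) * ε ^ (2 / 3 : ℝ))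
    + (m : ℝ) ^ 3 * (1 + Real.log m) * (Gf + γ * Gg) / (lam * √ε)

/-- The logarithmic quantity, free of `m`, a power of which the soft-O notation hides. -/
def logTerm (γ lam Lg Gf Gg ε : ℝ) : ℝ :=
  1 + Real.log (1 + (Gf + γ * Gg + γ * Lg) ^ 2 / (lam ^ 2 * ε))

end MidTouch

end

/-! The algorithm is a two-player game on the Lagrangian `f + γ ∑ p_k max(0, g_k)`: projected
stochastic subgradient descent in `w` against multiplicative weights in `p`. Since `γ > Lf / rho`,
the penalty is exact (`le_penalized`), and Sion's theorem then supplies a fixed multiplier `q` in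
the simplex for which the Lagrangian is minimized over `W` at `wstar`, with quadratic growth `lam /
2 * ‖w - wstar‖ ^ 2` (`exists_multiplier`). Distances to `wstar` can therefore be read off from
regrets, without separate control of objective and feasibility.

For the `w`-player, steps `1 / (lam t)` and strong convexity make the distances telescope
(`sum_regret_le`). The step counter is not reset between the phases, so the second phase starts with
the debt `lam / 2 * T₁ * ‖firstAverage - wstar‖ ^ 2`. The first phase bounds exactly this quantity
in expectation (`integral_firstAverage_le`), and the two harmonic sums join into one logarithm.

For the `p`-player, Hoeffding's lemma bounds the regret by `log m / η` plus `η` times the squared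
range of the supergradients. The positive parts vanish at `wstar`, so up to memory errors this range
is at most `γ Lg ‖w - wstar‖`; the choice of `η` turns its contribution into `lam / 8 * ‖w - wstar‖
^ 2`, which is absorbed by the `lam / 2` gained from the two convexity arguments and leaves the
factor `3 / 8`.

The memory errors matter both as bias of the range and as variance of the sampled correction. An
entry is refreshed with probability `1 / m`, and during the second phase the iterate moves by at
most `G / (lam T₁)` per step, where `G = Gf + γ Gg`; hence the mean squared error of an entry stays
below `6 m² (Lg G / (lam T₁))²` (`integral_memErr_le`). The first phase is made long enough to
render this harmless.

`sum_integral_secondPhase_le` combines all this, and `error_le` balances the lengths: `T₁` of order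
`m² G / (lam √ε)` and `T₂` of order `ℓ Λ (G + γ Lg)² / (lam² ε)`. The terms of the rates with
exponents `4/3` and `3/2` enter only through their nonnegativity. -/

namespace MidTouch

/-! ### Euclidean projections and subgradients relative to a convex set. -/

section Geometry

variable {d : ℕ} {S : Set (Vec d)}

lemma proj_spec (hne : S.Nonempty) (hcl : IsClosed S) (x : Vec d) :
    proj S x ∈ S ∧ ∀ z ∈ S, ‖x - proj S x‖ ≤ ‖x - z‖ := by
  obtain ⟨y, hy, hxy⟩ := hcl.exists_infDist_eq_dist hne x
  have h : ∃ y, y ∈ S ∧ ∀ z ∈ S, ‖x - y‖ ≤ ‖x - z‖ := by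
    refine ⟨y, hy, fun z hz => ?_⟩
    rw [← dist_eq_norm, ← dist_eq_norm, ← hxy]
    exact Metric.infDist_le_dist_of_mem hz
  exact Classical.epsilon_spec h

lemma inner_sub_proj_le (hne : S.Nonempty) (hcl : IsClosed S) (hcv : Convex ℝ S) (x : Vec d)
    {z : Vec d} (hz : z ∈ S) : inner ℝ (x - proj S x) (z - proj S x) ≤ 0 := by
  obtain ⟨hm, hmin⟩ := proj_spec hne hcl x
  refine (norm_eq_iInf_iff_real_inner_le_zero hcv hm).1 ?_ z hz
  have : Nonempty S := hne.to_subtype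
  exact le_antisymm (le_ciInf fun w => hmin w w.2)
    (ciInf_le (f := fun w : S => ‖x - w‖) ⟨0, Set.forall_mem_range.2 fun _ => norm_nonneg _⟩
      ⟨proj S x, hm⟩)

lemma norm_proj_sub_proj_le (hne : S.Nonempty) (hcl : IsClosed S) (hcv : Convex ℝ S)
    (x y : Vec d) : ‖proj S x - proj S y‖ ≤ ‖x - y‖ := by
  have h1 := inner_sub_proj_le hne hcl hcv x (proj_spec hne hcl y).1
  have h2 := inner_sub_proj_le hne hcl hcv y (proj_spec hne hcl x).1
  set a := proj S x
  set b := proj S y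
  have h3 : ‖a - b‖ ^ 2 ≤ inner ℝ (x - y) (a - b) := by
    rw [← real_inner_self_eq_norm_sq]
    have : inner ℝ (x - y) (a - b) - inner ℝ (a - b) (a - b)
        = -(inner ℝ (x - a) (b - a) + inner ℝ (y - b) (a - b)) := by
      rw [← neg_sub a b, inner_neg_right, ← inner_sub_left, ← sub_eq_zero]
      simp only [inner_sub_left]
      ring
    linarith
  have h4 := real_inner_le_norm (x - y) (a - b)
  by_contra! h
  nlinarith [norm_nonneg (x - y), norm_nonneg (a - b)]

lemma proj_of_mem {x : Vec d} (hx : x ∈ S) : proj S x = x := by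
  have h : ∃ y, y ∈ S ∧ ∀ z ∈ S, ‖x - y‖ ≤ ‖x - z‖ := ⟨x, hx, by simp⟩
  have := (Classical.epsilon_spec h).2 x hx
  rw [sub_self, norm_zero, norm_le_zero_iff, sub_eq_zero] at this
  exact this.symm

lemma norm_proj_sub_le (hne : S.Nonempty) (hcl : IsClosed S) (hcv : Convex ℝ S)
    (x : Vec d) {y : Vec d} (hy : y ∈ S) : ‖proj S x - y‖ ≤ ‖x - y‖ := by
  simpa [proj_of_mem hy] using norm_proj_sub_proj_le hne hcl hcv x y

/-- Needed for measurability of the random iterates and of the projected result. -/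
lemma continuous_proj (hne : S.Nonempty) (hcl : IsClosed S) (hcv : Convex ℝ S) :
    Continuous (proj S) := by
  refine (LipschitzWith.of_dist_le_mul (K := 1) fun x y => ?_).continuous
  simpa [dist_eq_norm] using norm_proj_sub_proj_le hne hcl hcv x y

/-- Test the subgradient inequality at `x + s (y - x)`, bound the value there by strong convexity,
divide by `s` and let `s` tend to `0`. -/
lemma IsSubgradient.strong {f : Vec d → ℝ} {lam : ℝ} {x y v : Vec d}
    (hf : StrongConvexOn S lam f) (hv : IsSubgradient S f x v) (hx : x ∈ S) (hy : y ∈ S) :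
    f x + inner ℝ v (y - x) + lam / 2 * ‖y - x‖ ^ 2 ≤ f y := by
  have key : ∀ s ∈ Set.Ioo (0 : ℝ) 1,
      inner ℝ v (y - x) ≤ f y - f x - (1 - s) * (lam / 2 * ‖y - x‖ ^ 2) := by
    rintro s ⟨hs0, hs1⟩
    have hz := hf.1 hx hy (by linarith : 0 ≤ 1 - s) hs0.le (by ring)
    have h1 := hf.2 hx hy (by linarith : 0 ≤ 1 - s) hs0.le (by ring)
    have h2 := hv _ hz
    have e : (1 - s) • x + s • y - x = s • (y - x) := by module
    rw [e, inner_smul_right] at h2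
    rw [norm_sub_rev x y] at h1
    simp only [smul_eq_mul] at h1
    have h3 : s * inner ℝ v (y - x)
        ≤ s * (f y - f x - (1 - s) * (lam / 2 * ‖y - x‖ ^ 2)) := by nlinarith
    exact le_of_mul_le_mul_left h3 hs0
  have hlim : Filter.Tendsto
      (fun s : ℝ => f y - f x - (1 - s) * (lam / 2 * ‖y - x‖ ^ 2))
      (nhdsWithin 0 (Set.Ioi 0)) (nhds (f y - f x - (1 - 0) * (lam / 2 * ‖y - x‖ ^ 2))) :=
    (Continuous.tendsto (by fun_prop) 0).mono_left nhdsWithin_le_nhds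
  have := ge_of_tendsto hlim (b := inner ℝ v (y - x)) (by
    filter_upwards [Ioo_mem_nhdsGT (zero_lt_one' ℝ)] with s hs using key s hs)
  linarith

/-- If `w` lies outside the zero sublevel set of a convex function and `b` is its projection onto
that set, then a positive multiple of `w - b` is a subgradient at `b`. -/
lemma exists_smul_isSubgradient {φ : Vec d → ℝ} {w b : Vec d} (hφ : ConvexOn ℝ S φ)
    (hcont : ContinuousOn φ S) (hw : w ∈ S) (hφw : 0 < φ w) (hb : b ∈ S) (hφb : φ b ≤ 0)
    (hproj : ∀ u ∈ S, φ u ≤ 0 → inner ℝ (w - b) (u - b) ≤ 0) :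
    φ b = 0 ∧ ∃ κ : ℝ, 0 ≤ κ ∧ IsSubgradient S φ b (κ • (w - b)) := by
  have hwb : w - b ≠ 0 := by
    intro h
    rw [sub_eq_zero.1 h] at hφw
    linarith
  have hpos : 0 < inner ℝ (w - b) (w - b) := by
    rw [real_inner_self_eq_norm_sq]; exact pow_pos (norm_pos_iff.2 hwb) 2
  have hA : ∀ u ∈ S, 0 < inner ℝ (w - b) (u - b) → 0 < φ u := fun u hu h => by
    by_contra! h'
    linarith [hproj u hu h']
  -- points on the supporting hyperplane
  have hB : ∀ u ∈ S, inner ℝ (w - b) (u - b) = 0 → 0 ≤ φ u := by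
    intro u hu h0
    by_contra! hneg
    have hc : ContinuousOn (fun s : ℝ => φ ((1 - s) • u + s • w)) (Set.Icc 0 1) := by
      refine hcont.comp (by fun_prop) fun s hs => ?_
      exact hφ.1 hu hw (by linarith [hs.2]) hs.1 (by ring)
    have h1 : ∀ᶠ s in nhdsWithin (0 : ℝ) (Set.Icc 0 1), φ ((1 - s) • u + s • w) < 0 := by
      refine (hc 0 (by simp)).eventually_lt_const (by simpa using hneg)
    have h2 := h1.filter_mono (nhdsWithin_mono _ (Set.Ioo_subset_Icc_self))
    have : (nhdsWithin (0 : ℝ) (Set.Ioo 0 1)).NeBot := by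
      rw [nhdsWithin_Ioo_eq_nhdsGT zero_lt_one]; infer_instance
    obtain ⟨s, hs, hs0, hs1⟩ := (h2.and self_mem_nhdsWithin).exists
    have hm := hφ.1 hu hw (by linarith : 0 ≤ 1 - s) hs0.le (by ring)
    have := hA _ hm (by
      have e : (1 - s) • u + s • w - b = (1 - s) • (u - b) + s • (w - b) := by module
      rw [e, inner_add_right, inner_smul_right, inner_smul_right, h0]
      simpa using mul_pos hs0 hpos)
    linarith
  have hb0 : φ b = 0 := le_antisymm hφb (hB b hb (by simp))
  refine ⟨hb0, ?_⟩
  -- The multiplier is the smallest slope of `φ` against the linear functional `⟨w - b, · - b⟩` on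
  -- its positive side.
  set A : Set ℝ := (fun u => φ u / inner ℝ (w - b) (u - b)) ''
    {u | u ∈ S ∧ 0 < inner ℝ (w - b) (u - b)} with hAdef
  have hAne : A.Nonempty := ⟨_, w, ⟨hw, hpos⟩, rfl⟩
  have hAlb : ∀ t ∈ A, 0 ≤ t := by
    rintro _ ⟨u, ⟨hu, h⟩, rfl⟩
    exact (div_pos (hA u hu h) h).le
  refine ⟨sInf A, Real.sInf_nonneg hAlb, fun u hu => ?_⟩
  rw [hb0, zero_add, real_inner_smul_left]
  rcases lt_trichotomy (inner ℝ (w - b) (u - b)) 0 with h | h | h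
  -- Slopes on the negative side do not exceed those on the positive side: the segment from `u₁` to
  -- `u` meets the hyperplane, where `φ` is nonnegative, and convexity compares the two ends.
  · have key : ∀ t ∈ A, φ u / inner ℝ (w - b) (u - b) ≤ t := by
      rintro _ ⟨u₁, ⟨hu₁, h₁⟩, rfl⟩
      set a₁ := inner ℝ (w - b) (u₁ - b)
      set a₂ := inner ℝ (w - b) (u - b)
      have hd : 0 < a₁ - a₂ := by linarith
      have ha : 0 ≤ -a₂ / (a₁ - a₂) := div_nonneg (by linarith) hd.le
      have hb' : 0 ≤ a₁ / (a₁ - a₂) := div_nonneg h₁.le hd.le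
      have hs : -a₂ / (a₁ - a₂) + a₁ / (a₁ - a₂) = 1 := by field_simp; ring
      have hm := hφ.1 hu₁ hu ha hb' hs
      have hv := hφ.2 hu₁ hu ha hb' hs
      have h0 := hB _ hm (by
        have e : (-a₂ / (a₁ - a₂)) • u₁ + (a₁ / (a₁ - a₂)) • u - b
            = (-a₂ / (a₁ - a₂)) • (u₁ - b) + (a₁ / (a₁ - a₂)) • (u - b)
              + ((-a₂ / (a₁ - a₂) + a₁ / (a₁ - a₂)) - 1) • b := by module
        rw [e, hs, sub_self, zero_smul, add_zero, inner_add_right, inner_smul_right,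
          inner_smul_right]
        change -a₂ / (a₁ - a₂) * a₁ + a₁ / (a₁ - a₂) * a₂ = 0
        ring)
      have h2 : 0 ≤ -a₂ * φ u₁ + a₁ * φ u := by
        have := le_trans h0 hv
        simp only [smul_eq_mul] at this
        have e : -a₂ / (a₁ - a₂) * φ u₁ + a₁ / (a₁ - a₂) * φ u
            = (-a₂ * φ u₁ + a₁ * φ u) / (a₁ - a₂) := by ring
        rw [e] at this
        by_contra! hlt
        linarith [div_neg_of_neg_of_pos hlt hd]
      change φ u / a₂ ≤ φ u₁ / a₁
      rw [div_le_iff_of_neg h, div_mul_eq_mul_div, div_le_iff₀ h₁]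
      linarith
    have := le_csInf hAne key
    rwa [div_le_iff_of_neg h] at this
  · rw [h, mul_zero]; exact hB u hu h
  · have : sInf A ≤ φ u / inner ℝ (w - b) (u - b) := csInf_le ⟨0, hAlb⟩ ⟨u, ⟨hu, h⟩, rfl⟩
    rwa [le_div_iff₀ h] at this

end Geometry

/-! ### Exact penalization and the saddle point of the Lagrangian. -/

section Problem

variable {d m : ℕ} {P : Problem d m}

/-- The positive part of the `k`-th constraint. -/
noncomputable def Problem.gpos (P : Problem d m) (k : Fin m) (w : Vec d) : ℝ := max 0 (P.g k w)

/-- The objective plus the constraint violations weighted by `γ p`. -/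
noncomputable def Problem.lagrangian (P : Problem d m) (γ : ℝ) (w : Vec d) (p : Fin m → ℝ) : ℝ :=
  P.f w + γ * ∑ k, p k * P.gpos k w

lemma gpos_nonneg (k : Fin m) (w : Vec d) : 0 ≤ P.gpos k w := le_max_left _ _

lemma gpos_eq_zero {w : Vec d} (hw : w ∈ P.feasible) (k : Fin m) : P.gpos k w = 0 :=
  max_eq_left (hw.2 k)

lemma le_gmax (i : Fin m) (w : Vec d) : P.g i w ≤ P.gmax w :=
  le_ciSup (Set.finite_range fun i => P.g i w).bddAbove i

variable {lam Lf Lg rho γ : ℝ} {wstar : Vec d}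

lemma Problem.Admissible.gpos_lipschitz (hP : P.Admissible lam Lf Lg rho) (k : Fin m) {w w' : Vec d}
    (hw : w ∈ P.W) (hw' : w' ∈ P.W) : |P.gpos k w - P.gpos k w'| ≤ Lg * ‖w - w'‖ := by
  refine le_trans ?_ (hP.lipschitz_g k w hw w' hw')
  simpa [Problem.gpos, max_comm] using abs_max_sub_max_le_abs (P.g k w) (P.g k w') 0

lemma continuousOn_of_lipschitz {φ : Vec d → ℝ} {S : Set (Vec d)} {L : ℝ}
    (h : ∀ w ∈ S, ∀ w' ∈ S, |φ w - φ w'| ≤ L * ‖w - w'‖) : ContinuousOn φ S := by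
  refine (LipschitzOnWith.of_dist_le_mul (K := L.toNNReal) fun x hx y hy => ?_).continuousOn
  rw [Real.dist_eq, dist_eq_norm]
  exact (h x hx y hy).trans (mul_le_mul_of_nonneg_right (Real.le_coe_toNNReal L) (norm_nonneg _))

lemma Problem.Admissible.continuousOn_f (hP : P.Admissible lam Lf Lg rho) :
    ContinuousOn P.f P.W :=
  continuousOn_of_lipschitz hP.lipschitz_f

lemma Problem.Admissible.continuousOn_gpos (hP : P.Admissible lam Lf Lg rho) (k : Fin m) :
    ContinuousOn (P.gpos k) P.W :=
  continuousOn_of_lipschitz fun _ hw _ hw' => hP.gpos_lipschitz k hw hw'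

lemma Problem.Admissible.gpos_le (hP : P.Admissible lam Lf Lg rho) (hs : wstar ∈ P.feasible)
    (k : Fin m) {w : Vec d} (hw : w ∈ P.W) : P.gpos k w ≤ Lg * ‖w - wstar‖ := by
  have := hP.gpos_lipschitz k hw hs.1
  rw [gpos_eq_zero hs, sub_zero] at this
  exact (le_abs_self _).trans this

lemma Problem.Admissible.convexOn_gpos (hP : P.Admissible lam Lf Lg rho) (k : Fin m) :
    ConvexOn ℝ P.W (P.gpos k) :=
  (convexOn_const 0 hP.convex).sup (hP.convex_g k)

lemma Problem.Admissible.isClosed_feasible (hP : P.Admissible lam Lf Lg rho) :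
    IsClosed P.feasible := by
  have : P.feasible = P.W ∩ ⋂ i, {w | w ∈ P.W ∧ P.g i w ≤ 0} := by
    ext w
    simp only [Problem.feasible, Set.mem_inter_iff, Set.mem_iInter, Set.mem_ofPred_eq]
    exact ⟨fun h => ⟨h.1, fun i => ⟨h.1, h.2 i⟩⟩, fun h => ⟨h.1, fun i => (h.2 i).2⟩⟩
  rw [this]
  refine hP.closed.inter (isClosed_iInter fun i => ?_)
  exact (continuousOn_of_lipschitz (hP.lipschitz_g i)).preimage_isClosed_of_isClosed
    hP.closed isClosed_Iic

lemma Problem.Admissible.convex_feasible (hP : P.Admissible lam Lf Lg rho) :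
    Convex ℝ P.feasible := by
  intro x hx y hy a b ha hb hab
  refine ⟨hP.convex hx.1 hy.1 ha hb hab, fun i => ?_⟩
  have := (hP.convex_g i).2 hx.1 hy.1 ha hb hab
  simp only [smul_eq_mul] at this
  nlinarith [hx.2 i, hy.2 i]

variable [Nonempty (Fin m)]

lemma gmax_le {w : Vec d} {c : ℝ} (h : ∀ i, P.g i w ≤ c) : P.gmax w ≤ c := ciSup_le h

lemma exists_eq_gmax (w : Vec d) : ∃ i, P.g i w = P.gmax w := exists_eq_ciSup_of_finite

lemma Problem.Admissible.convexOn_gmax (hP : P.Admissible lam Lf Lg rho) :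
    ConvexOn ℝ P.W P.gmax := by
  refine ⟨hP.convex, fun x hx y hy a b ha hb hab => gmax_le fun i => ?_⟩
  refine ((hP.convex_g i).2 hx hy ha hb hab).trans ?_
  exact add_le_add (smul_le_smul_of_nonneg_left (le_gmax i x) ha)
    (smul_le_smul_of_nonneg_left (le_gmax i y) hb)

lemma Problem.Admissible.continuousOn_gmax (hP : P.Admissible lam Lf Lg rho) :
    ContinuousOn P.gmax P.W := by
  have key : ∀ w ∈ P.W, ∀ w' ∈ P.W, P.gmax w - P.gmax w' ≤ Lg * ‖w - w'‖ := by
    intro w hw w' hw'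
    obtain ⟨i, hi⟩ := exists_eq_gmax (P := P) w
    have h1 := le_gmax (P := P) i w'
    have h2 := (le_abs_self _).trans (hP.lipschitz_g i w hw w' hw')
    linarith
  refine continuousOn_of_lipschitz (L := Lg) fun w hw w' hw' => abs_sub_le_iff.2
    ⟨key w hw w' hw', ?_⟩
  rw [norm_sub_rev]
  exact key w' hw' w hw

/-- An error bound: the subgradient `κ (w - b)` at the projection `b` has norm at least `rho`, while
its inequality at `w` reads `κ ‖w - b‖² ≤ gmax w`. -/
lemma Problem.Admissible.mul_norm_sub_proj_le (hP : P.Admissible lam Lf Lg rho)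
    (hne : P.feasible.Nonempty) {w : Vec d} (hw : w ∈ P.W) (hgw : 0 < P.gmax w) :
    rho * ‖w - proj P.feasible w‖ ≤ P.gmax w := by
  have hcl := hP.isClosed_feasible
  set b := proj P.feasible w with hbdef
  have hb : b ∈ P.feasible := (proj_spec hne hcl w).1
  obtain ⟨hb0, κ, hκ, hsub⟩ := exists_smul_isSubgradient hP.convexOn_gmax hP.continuousOn_gmax hw
    hgw hb.1 (gmax_le hb.2) fun u hu hgu =>
      inner_sub_proj_le hne hcl hP.convex_feasible w ⟨hu, fun i => (le_gmax i u).trans hgu⟩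
  have h1 := hP.boundary b hb.1 hb0 _ hsub
  have h2 := hsub w hw
  rw [hb0, zero_add, real_inner_smul_left, real_inner_self_eq_norm_sq] at h2
  rw [norm_smul, Real.norm_eq_abs, abs_of_nonneg hκ] at h1
  nlinarith [norm_nonneg (w - b)]

/-- Exact penalization. -/
lemma Problem.Admissible.le_penalized (hP : P.Admissible lam Lf Lg rho) (hγ : Lf / rho < γ)
    (hγ0 : 0 < γ) (hopt : P.IsOptimum wstar) {w : Vec d} (hw : w ∈ P.W) :
    P.f wstar ≤ P.f w + γ * max 0 (P.gmax w) := by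
  rcases le_or_gt (P.gmax w) 0 with h | h
  · have := hopt.2 w ⟨hw, fun i => (le_gmax i w).trans h⟩
    simpa [max_eq_left h] using this
  · have hne : P.feasible.Nonempty := ⟨_, hopt.1⟩
    have hb := (proj_spec hne hP.isClosed_feasible w).1
    have h1 := hP.mul_norm_sub_proj_le hne hw h
    have h2 := hopt.2 _ hb
    have h3 := (abs_le.1 (hP.lipschitz_f w hw _ hb.1)).1
    rw [max_eq_right h.le]
    have h4 := (div_lt_iff₀ hP.rho_pos).1 hγ
    have h5 := mul_le_mul_of_nonneg_right h4.le (norm_nonneg (w - proj P.feasible w))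
    have h6 := mul_le_mul_of_nonneg_left h1 hγ0.le
    linarith

omit [Nonempty (Fin m)] in
lemma lagrangian_of_feasible (hs : wstar ∈ P.feasible) (p : Fin m → ℝ) :
    P.lagrangian γ wstar p = P.f wstar := by
  simp [Problem.lagrangian, gpos_eq_zero hs]

omit [Nonempty (Fin m)] in
lemma Problem.Admissible.strongConvexOn_lagrangian (hP : P.Admissible lam Lf Lg rho) (hγ0 : 0 < γ)
    {p : Fin m → ℝ} (hp : ∀ k, 0 ≤ p k) :
    StrongConvexOn P.W lam fun w => P.lagrangian γ w p := by
  refine ⟨hP.convex, fun x hx y hy a b ha hb hab => ?_⟩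
  have h1 := hP.strongConvex.2 hx hy ha hb hab
  have h2 : ∑ k, p k * P.gpos k (a • x + b • y)
      ≤ ∑ k, (a * (p k * P.gpos k x) + b * (p k * P.gpos k y)) := by
    refine Finset.sum_le_sum fun k _ => ?_
    have := (hP.convexOn_gpos k).2 hx hy ha hb hab
    simp only [smul_eq_mul] at this
    nlinarith [mul_le_mul_of_nonneg_left this (hp k)]
  rw [Finset.sum_add_distrib, ← Finset.mul_sum, ← Finset.mul_sum] at h2
  have h3 := mul_le_mul_of_nonneg_left h2 hγ0.le
  simp only [Problem.lagrangian, smul_eq_mul] at *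
  linarith

/-- The multiplier is the dual half of a saddle point. Exact penalization makes `wstar` a minimizer
for it, and strong convexity around a minimizer gives the growth. -/
lemma Problem.Admissible.exists_multiplier (hP : P.Admissible lam Lf Lg rho) (hγ : Lf / rho < γ)
    (hγ0 : 0 < γ) (hlam : 0 ≤ lam) (hopt : P.IsOptimum wstar) :
    ∃ p ∈ stdSimplex ℝ (Fin m), ∀ w ∈ P.W,
      P.f wstar + lam / 2 * ‖w - wstar‖ ^ 2 ≤ P.lagrangian γ w p := by
  have hcont : ∀ p : Fin m → ℝ, ContinuousOn (fun w => P.lagrangian γ w p) P.W := fun p =>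
    hP.continuousOn_f.add (continuousOn_const.mul
      (continuousOn_finsetSum _ fun k _ => continuousOn_const.mul (hP.continuousOn_gpos k)))
  have hlin : ∀ w : Vec d, ConcaveOn ℝ (stdSimplex ℝ (Fin m)) fun p => P.lagrangian γ w p := by
    refine fun w => ⟨convex_stdSimplex ℝ _, fun p _ q _ a b _ _ hab => le_of_eq ?_⟩
    simp only [Problem.lagrangian, smul_eq_mul, Pi.add_apply, Pi.smul_apply, add_mul,
      Finset.sum_add_distrib, mul_assoc, ← Finset.mul_sum]
    linear_combination (P.f w) * hab
  have hsc : ∀ p ∈ stdSimplex ℝ (Fin m), StrongConvexOn P.W lam fun w => P.lagrangian γ w p :=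
    fun p hp => hP.strongConvexOn_lagrangian hγ0 hp.1
  have hcvx : ∀ p ∈ stdSimplex ℝ (Fin m), ConvexOn ℝ P.W fun w => P.lagrangian γ w p :=
    fun p hp => strongConvexOn_zero.1 ((hsc p hp).mono hlam)
  obtain ⟨a, ha, b, hb, hab⟩ := Sion.exists_isSaddlePointOn (X := P.W) (Y := stdSimplex ℝ (Fin m))
    (f := fun w p => P.lagrangian γ w p) ⟨wstar, hopt.1.1⟩ hP.convex
    (Metric.isCompact_of_isClosed_isBounded hP.closed hP.bounded)
    (fun p _ => (hcont p).lowerSemicontinuousOn)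
    (fun p hp => (hcvx p hp).quasiconvexOn)
    (convex_stdSimplex ℝ _) ⟨_, single_mem_stdSimplex ℝ (Classical.arbitrary (Fin m))⟩
    (isCompact_stdSimplex ℝ _)
    (fun w _ => by
      refine ContinuousOn.upperSemicontinuousOn (Continuous.continuousOn ?_)
      unfold Problem.lagrangian
      fun_prop)
    (fun w _ => (hlin w).quasiconcaveOn)
  refine ⟨b, hb, fun w hw => ?_⟩
  -- With `i` a most violated constraint at the primal half `a`, the vertex at `i` gives `f wstar ≤
  -- L(a, e_i) ≤ L(u, b)` for every `u` in the domain.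
  have hmin : IsSubgradient P.W (fun w => P.lagrangian γ w b) wstar 0 := by
    intro u hu
    simp only [inner_zero_left, add_zero]
    rw [lagrangian_of_feasible hopt.1]
    obtain ⟨i, hi⟩ := exists_eq_gmax (P := P) a
    have h1 := hab u hu _ (single_mem_stdSimplex ℝ i)
    refine (hP.le_penalized hγ hγ0 hopt ha).trans (le_trans (le_of_eq ?_) h1)
    simp [Problem.lagrangian, Pi.single_apply, Problem.gpos, hi]
  have := hmin.strong (hsc b hb) hopt.1.1 hw
  rwa [inner_zero_left, add_zero, lagrangian_of_feasible hopt.1] at this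

end Problem

/-! ### Regret of the multiplicative weights update. -/

section Hedge

/-- Hoeffding's lemma for a finitely supported distribution. -/
lemma sum_mul_exp_le {ι : Type*} [Fintype ι] {p : ι → ℝ} (hp : p ∈ stdSimplex ℝ ι) {x : ι → ℝ}
    {a b : ℝ} (hx : ∀ k, x k ∈ Set.Icc a b) :
    ∑ k, p k * Real.exp (x k) ≤ Real.exp (∑ k, p k * x k + (b - a) ^ 2 / 8) := by
  let _ : MeasurableSpace ι := ⊤
  set μ : Measure ι := ∑ k, ENNReal.ofReal (p k) • Measure.dirac k with hμ
  have hint : ∀ φ : ι → ℝ, ∫ k, φ k ∂μ = ∑ k, p k * φ k := by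
    intro φ
    rw [hμ, integral_finsetSum_measure fun k _ =>
      (integrable_dirac (by simp)).smul_measure ENNReal.ofReal_ne_top]
    simp [integral_smul_measure, ENNReal.toReal_ofReal (hp.1 _)]
  have : IsProbabilityMeasure μ := ⟨by
    simp only [hμ, Measure.coe_finsetSum, Finset.sum_apply, Measure.smul_apply, smul_eq_mul,
      measure_univ, mul_one]
    rw [← ENNReal.ofReal_sum_of_nonneg fun k _ => hp.1 k, hp.2, ENNReal.ofReal_one]⟩
  have h := (ProbabilityTheory.hasSubgaussianMGF_of_mem_Icc (μ := μ) (X := x) (a := a) (b := b)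
    (measurable_of_finite x).aemeasurable (ae_of_all _ hx)).mgf_le 1
  rw [ProbabilityTheory.mgf, hint, hint] at h
  -- The library bound concerns the centred variable, so the exponential of the mean is factored
  -- out.
  have e : ∑ k, p k * Real.exp (x k)
      = Real.exp (∑ k, p k * x k) * ∑ k, p k * Real.exp (1 * (x k - ∑ k, p k * x k)) := by
    rw [Finset.mul_sum]
    refine Finset.sum_congr rfl fun k _ => ?_
    rw [mul_left_comm, ← Real.exp_add]
    congr 2
    ring
  rw [e, Real.exp_add]
  refine mul_le_mul_of_nonneg_left (h.trans (le_of_eq ?_)) (Real.exp_pos _).le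
  congr 1
  push_cast
  rw [Real.norm_eq_abs, div_pow, sq_abs]
  ring

variable {m : ℕ} {H : Hyper}

/-- The cross entropy of `p` relative to `q`. -/
noncomputable def crossEntropy (q p : Fin m → ℝ) : ℝ := -∑ k, q k * Real.log (p k)

/-- Cross entropy serves as the potential: it differs from relative entropy by a constant depending
on `q` only, which cancels in differences, and it needs only this lower bound at the final time. -/
lemma crossEntropy_nonneg {q p : Fin m → ℝ} (hq : ∀ k, 0 ≤ q k) (hp : p ∈ stdSimplex ℝ (Fin m)) :
    0 ≤ crossEntropy q p := by
  rw [crossEntropy, Left.nonneg_neg_iff]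
  refine Finset.sum_nonpos fun k _ => mul_nonpos_of_nonneg_of_nonpos (hq k) ?_
  refine Real.log_nonpos (hp.1 k) ?_
  rw [← hp.2]
  exact Finset.single_le_sum (fun i _ => hp.1 i) (Finset.mem_univ k)

/-- Positivity matters: since `Real.log 0 = 0`, a vanishing weight would be treated as `1`. -/
lemma pUpdate_apply {p : Fin m → ℝ} (hp : ∀ k, 0 < p k) (s : Fin m → ℝ) (k : Fin m) :
    pUpdate H p s k = p k * Real.exp (H.η * s k) / ∑ l, p l * Real.exp (H.η * s l) := by
  have h : ∀ k, Real.exp (Real.log (p k) + H.η * s k) = p k * Real.exp (H.η * s k) := fun k => by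
    rw [Real.exp_add, Real.exp_log (hp k)]
  simp only [pUpdate, Real.abs_exp]
  simp only [h]

variable [Nonempty (Fin m)]

lemma sum_mul_exp_pos {p : Fin m → ℝ} (hp : ∀ k, 0 < p k) (s : Fin m → ℝ) :
    0 < ∑ l, p l * Real.exp (H.η * s l) :=
  Finset.sum_pos (fun l _ => mul_pos (hp l) (Real.exp_pos _)) Finset.univ_nonempty

lemma pUpdate_pos {p : Fin m → ℝ} (hp : ∀ k, 0 < p k) (s : Fin m → ℝ) (k : Fin m) :
    0 < pUpdate H p s k := by
  rw [pUpdate_apply hp]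
  exact div_pos (mul_pos (hp k) (Real.exp_pos _)) (sum_mul_exp_pos hp s)

lemma sum_pUpdate {p : Fin m → ℝ} (hp : ∀ k, 0 < p k) (s : Fin m → ℝ) :
    ∑ k, pUpdate H p s k = 1 := by
  simp only [pUpdate_apply hp]
  rw [← Finset.sum_div, div_self (sum_mul_exp_pos hp s).ne']

/-- One step of the regret analysis of the multiplicative update. -/
lemma regret_pUpdate_le {q p : Fin m → ℝ} (hq : q ∈ stdSimplex ℝ (Fin m)) (hp : ∀ k, 0 < p k)
    (hp1 : ∑ k, p k = 1) (hη : 0 ≤ H.η) {s : Fin m → ℝ} {a b : ℝ} (hs : ∀ k, s k ∈ Set.Icc a b) :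
    H.η * ∑ k, (q k - p k) * s k
      ≤ crossEntropy q p - crossEntropy q (pUpdate H p s) + H.η ^ 2 * (b - a) ^ 2 / 8 := by
  have hZ := sum_mul_exp_pos (H := H) hp s
  have h1 := sum_mul_exp_le (p := p) ⟨fun k => (hp k).le, hp1⟩ (x := fun k => H.η * s k)
    (a := H.η * a) (b := H.η * b) fun k =>
      ⟨mul_le_mul_of_nonneg_left (hs k).1 hη, mul_le_mul_of_nonneg_left (hs k).2 hη⟩
  have h2 := (Real.log_le_iff_le_exp hZ).2 h1
  have h3 : ∀ k, Real.log (pUpdate H p s k)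
      = Real.log (p k) + H.η * s k - Real.log (∑ l, p l * Real.exp (H.η * s l)) := fun k => by
    rw [pUpdate_apply hp, Real.log_div (mul_pos (hp k) (Real.exp_pos _)).ne' hZ.ne',
      Real.log_mul (hp k).ne' (Real.exp_pos _).ne', Real.log_exp]
  set Z := Real.log (∑ l, p l * Real.exp (H.η * s l))
  -- The potential changes by `-η ⟨q, s⟩` plus the log-normalizer, and Hoeffding's lemma bounds the
  -- latter by `η ⟨p, s⟩` plus the range term.
  have h4 : crossEntropy q (pUpdate H p s) = crossEntropy q p - H.η * ∑ k, q k * s k + Z := by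
    simp only [crossEntropy, h3]
    have : ∑ k, q k * (Real.log (p k) + H.η * s k - Z)
        = ∑ k, q k * Real.log (p k) + H.η * ∑ k, q k * s k - (∑ k, q k) * Z := by
      rw [Finset.mul_sum, Finset.sum_mul, ← Finset.sum_add_distrib, ← Finset.sum_sub_distrib]
      exact Finset.sum_congr rfl fun k _ => by ring
    rw [this, hq.2]
    ring
  have h5 : ∑ k, p k * (H.η * s k) = H.η * ∑ k, p k * s k := by
    rw [Finset.mul_sum]; exact Finset.sum_congr rfl fun k _ => by ring
  rw [h5] at h2
  simp only [sub_mul, Finset.sum_sub_distrib]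
  rw [h4]
  nlinarith

/-- The range of the stochastic supergradient, in terms of the current positive parts `x` of the
constraints and the errors of the remembered values. -/
lemma regret_pGradient_le {q p mu x : Fin m → ℝ} (hq : q ∈ stdSimplex ℝ (Fin m))
    (hp : ∀ k, 0 < p k) (hp1 : ∑ k, p k = 1) (hη : 0 ≤ H.η) (hγ : 0 ≤ H.γ) {B : ℝ}
    (hx : ∀ k, 0 ≤ x k ∧ x k ≤ B) (j : Fin m) :
    H.η * ∑ k, (q k - p k) * pGradient H mu j (x j) k
      ≤ crossEntropy q p - crossEntropy q (pUpdate H p (pGradient H mu j (x j)))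
        + H.η ^ 2 * (H.γ ^ 2 * (B ^ 2 / 4
          + 2 * (∑ k, (x k - mu k) ^ 2 + m ^ 2 * (x j - mu j) ^ 2))) := by
  set r := √(∑ k, (x k - mu k) ^ 2) with hr
  have hr2 : r ^ 2 = ∑ k, (x k - mu k) ^ 2 :=
    Real.sq_sqrt (Finset.sum_nonneg fun k _ => sq_nonneg _)
  have hdr : ∀ k, |x k - mu k| ≤ r := fun k => Real.abs_le_sqrt
    (Finset.single_le_sum (f := fun k => (x k - mu k) ^ 2) (fun i _ => sq_nonneg _)
      (Finset.mem_univ k))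
  set E := r + m * |x j - mu j| with hE
  have hm0 : 0 ≤ (m : ℝ) * |x j - mu j| := by positivity
  -- Each `mu k` is within `r` of a number in `[0, B]`, and the sampled correction adds at most `m
  -- |x j - mu j|`. Then `(B + 2E)² / 8 ≤ B² / 4 + E²`, and `E²` splits with a factor `2`.
  have hs : ∀ k, pGradient H mu j (x j) k ∈ Set.Icc (-(H.γ * E)) (H.γ * (B + E)) := by
    intro k
    have h1 := abs_le.1 (hdr k)
    have h2 := hx k
    have h3 : -(m * |x j - mu j|) ≤ (if k = j then m * (x j - mu j) else 0) ∧
        (if k = j then m * (x j - mu j) else 0) ≤ m * |x j - mu j| := by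
      split_ifs
      · constructor
        · have := mul_le_mul_of_nonneg_left (neg_abs_le (x j - mu j)) (Nat.cast_nonneg (α := ℝ) m)
          linarith
        · exact mul_le_mul_of_nonneg_left (le_abs_self _) (Nat.cast_nonneg _)
      · exact ⟨by linarith, hm0⟩
    have e : pGradient H mu j (x j) k
        = H.γ * (mu k + if k = j then m * (x j - mu j) else 0) := by
      simp only [pGradient]
      split_ifs <;> ring
    rw [e, ← mul_neg]
    exact ⟨mul_le_mul_of_nonneg_left (by linarith) hγ, mul_le_mul_of_nonneg_left (by linarith) hγ⟩
  refine (regret_pUpdate_le hq hp hp1 hη hs).trans ?_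
  rw [← hr2]
  have h1 : (H.γ * (B + E) - -(H.γ * E)) ^ 2 / 8 ≤ H.γ ^ 2 * (B ^ 2 / 4
      + 2 * (r ^ 2 + m ^ 2 * (x j - mu j) ^ 2)) := by
    have e : (H.γ * (B + E) - -(H.γ * E)) ^ 2 / 8 = H.γ ^ 2 * ((B + 2 * E) ^ 2 / 8) := by ring
    rw [e]
    refine mul_le_mul_of_nonneg_left ?_ (sq_nonneg _)
    have e2 : (m : ℝ) ^ 2 * (x j - mu j) ^ 2 = (m * |x j - mu j|) ^ 2 := by
      rw [mul_pow, sq_abs]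
    rw [e2]
    nlinarith [sq_nonneg (B - 2 * E), sq_nonneg (r - m * |x j - mu j|)]
  have h2 := mul_le_mul_of_nonneg_left h1 (sq_nonneg H.η)
  linarith

end Hedge

lemma Counted.pure_eq {α : Type} (a : α) : (pure a : Counted α) = ⟨a, 0⟩ := rfl

lemma Counted.bind_eq {α β : Type} (c : Counted α) (k : α → Counted β) :
    c >>= k = ⟨(k c.val).val, c.checks + (k c.val).checks⟩ := rfl

/-! ### Recursions, check counts and invariants of a single execution. -/

section Trajectory

variable {d m : ℕ} {P : Problem d m} {O : Oracle d m} {H : Hyper} {D : Draws d m}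

lemma firstPhase_succ (n : ℕ) : (firstPhase P O H D (n + 1)).val =
    wUpdate P H D (n + 1) (firstPhase P O H D n).val
      (O.grad (O.sel fun i => P.g i (firstPhase P O H D n).val) (firstPhase P O H D n).val) := rfl

lemma checks_firstPhase (n : ℕ) : (firstPhase P O H D n).checks = n * (m + 1) := by
  induction n with
  | zero => simp [firstPhase, Counted.pure_eq]
  | succ n ih =>
    simp only [firstPhase, Counted.bind_eq, Counted.pure_eq, Counted.all, evalConstraint,
      diffConstraint, ih]
    simp
    ring

lemma secondPhase_zero_w : (secondPhase P O H D 0).val.w = firstAverage P O H D := rfl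

lemma secondPhase_zero_p (k : Fin m) : (secondPhase P O H D 0).val.p k = 1 / (m : ℝ) := rfl

lemma secondPhase_zero_mu (k : Fin m) :
    (secondPhase P O H D 0).val.mu k = P.gpos k (firstAverage P O H D) := rfl

lemma secondPhase_succ_w (n : ℕ) : (secondPhase P O H D (n + 1)).val.w =
    wUpdate P H D (H.T₁ + n + 1) (secondPhase P O H D n).val.w
      (O.grad (D.i (H.T₁ + n + 1)) (secondPhase P O H D n).val.w) := rfl

lemma secondPhase_succ_p (n : ℕ) : (secondPhase P O H D (n + 1)).val.p =
    pUpdate H (secondPhase P O H D n).val.p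
      (pGradient H (secondPhase P O H D n).val.mu (D.j (H.T₁ + n + 1))
        (P.gpos (D.j (H.T₁ + n + 1)) (secondPhase P O H D n).val.w)) := rfl

lemma secondPhase_succ_mu (n : ℕ) (k : Fin m) : (secondPhase P O H D (n + 1)).val.mu k =
    if D.j (H.T₁ + n + 1) = k then P.gpos k (secondPhase P O H D n).val.w
      else (secondPhase P O H D n).val.mu k := by
  change Function.update (secondPhase P O H D n).val.mu (D.j (H.T₁ + n + 1))
    (P.gpos (D.j (H.T₁ + n + 1)) (secondPhase P O H D n).val.w) k = _
  rw [Function.update_apply]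
  by_cases h : D.j (H.T₁ + n + 1) = k
  · simp [h]
  · simp [h, Ne.symm h]

/-- On the diagonal `x j` may be replaced by `x k`; the index `j` then enters only through an
indicator, convenient for measurability and for averaging over `j`. -/
lemma pGradient_apply (mu x : Fin m → ℝ) (j k : Fin m) :
    pGradient H mu j (x j) k
      = H.γ * mu k + if j = k then H.γ * m * (x k - mu k) else 0 := by
  unfold pGradient
  by_cases h : j = k
  · simp [h]
  · simp [h, Ne.symm h]

lemma checks_secondPhase (n : ℕ) :
    (secondPhase P O H D n).checks = H.T₁ * (m + 1) + m + 2 * n := by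
  induction n with
  | zero =>
    simp only [secondPhase, Counted.bind_eq, Counted.pure_eq, Counted.all, evalConstraint,
      checks_firstPhase]
    simp
  | succ n ih =>
    simp only [secondPhase, secondStep, Counted.bind_eq, Counted.pure_eq, evalConstraint,
      diffConstraint, ih]
    ring

lemma totalChecks_eq : totalChecks P O H D = H.T₁ * (m + 1) + m + 2 * H.T₂ :=
  checks_secondPhase _

variable {lam Lf Lg rho : ℝ} {wstar : Vec d} (hP : P.Admissible lam Lf Lg rho)
  (hs : wstar ∈ P.feasible)
include hP hs

lemma wUpdate_mem (t : ℕ) (w v : Vec d) : wUpdate P H D t w v ∈ P.W :=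
  (proj_spec ⟨_, hs.1⟩ hP.closed _).1

/-- The basic inequality for the projected step. -/
lemma norm_wUpdate_sub_sq_le (t : ℕ) (w v : Vec d) :
    ‖wUpdate P H D t w v - wstar‖ ^ 2 ≤ ‖w - wstar‖ ^ 2
      - 2 / (H.lam * t) * inner ℝ (D.sg t + H.γ • v) (w - wstar)
      + (1 / (H.lam * t)) ^ 2 * ‖D.sg t + H.γ • v‖ ^ 2 := by
  have h := norm_proj_sub_le ⟨_, hs.1⟩ hP.closed hP.convex
    (w - (1 / (H.lam * t)) • (D.sg t + H.γ • v)) hs.1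
  have h2 := pow_le_pow_left₀ (norm_nonneg _) h 2
  refine h2.trans (le_of_eq ?_)
  rw [sub_right_comm, norm_sub_sq_real, inner_smul_right, norm_smul, mul_pow, Real.norm_eq_abs,
    sq_abs, real_inner_comm]
  ring

lemma norm_wUpdate_sub_le (hlam : 0 < H.lam) (t : ℕ) {w : Vec d} (hw : w ∈ P.W) (v : Vec d) :
    ‖wUpdate P H D t w v - w‖ ≤ 1 / (H.lam * t) * ‖D.sg t + H.γ • v‖ := by
  have h := norm_proj_sub_le ⟨_, hs.1⟩ hP.closed hP.convex
    (w - (1 / (H.lam * t)) • (D.sg t + H.γ • v)) hw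
  refine h.trans (le_of_eq ?_)
  rw [sub_sub_cancel_left, norm_neg, norm_smul, Real.norm_eq_abs, abs_of_nonneg (by positivity)]

lemma firstPhase_mem (h0 : D.w₁ ∈ P.W) (n : ℕ) : (firstPhase P O H D n).val ∈ P.W := by
  cases n with
  | zero => exact h0
  | succ n => exact wUpdate_mem hP hs _ _ _

omit hs in
lemma average_mem {x : ℕ → Vec d} (hx : ∀ n, x n ∈ P.W) {N : ℕ} (hN : 0 < N) :
    (1 / (N : ℝ)) • ∑ n ∈ Finset.range N, x n ∈ P.W := by
  rw [Finset.smul_sum]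
  refine hP.convex.sum_mem (fun _ _ => by positivity) ?_ fun n _ => hx n
  have : (N : ℝ) ≠ 0 := by positivity
  simp [this]

lemma firstAverage_mem (h0 : D.w₁ ∈ P.W) (hT : 0 < H.T₁) : firstAverage P O H D ∈ P.W :=
  average_mem hP (firstPhase_mem hP hs h0) hT

lemma secondPhase_w_mem (h0 : D.w₁ ∈ P.W) (hT : 0 < H.T₁) (n : ℕ) :
    (secondPhase P O H D n).val.w ∈ P.W := by
  cases n with
  | zero => exact firstAverage_mem hP hs h0 hT
  | succ n => exact wUpdate_mem hP hs _ _ _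

lemma secondPhase_mu_mem (h0 : D.w₁ ∈ P.W) (hT : 0 < H.T₁) {c : ℝ}
    (hc : ∀ k, ∀ w ∈ P.W, P.gpos k w ≤ c) (n : ℕ) (k : Fin m) :
    (secondPhase P O H D n).val.mu k ∈ Set.Icc 0 c := by
  induction n with
  | zero => exact ⟨gpos_nonneg _ _, hc _ _ (firstAverage_mem hP hs h0 hT)⟩
  | succ n ih =>
    rw [secondPhase_succ_mu]
    split_ifs
    · exact ⟨gpos_nonneg _ _, hc _ _ (secondPhase_w_mem hP hs h0 hT n)⟩
    · exact ih

omit hP hs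

lemma norm_average_sub_sq_le {x : ℕ → Vec d} {y : Vec d} {N : ℕ} (hN : 0 < N) :
    ‖(1 / (N : ℝ)) • ∑ n ∈ Finset.range N, x n - y‖ ^ 2
      ≤ 1 / (N : ℝ) * ∑ n ∈ Finset.range N, ‖x n - y‖ ^ 2 := by
  have hN' : (N : ℝ) ≠ 0 := by positivity
  have e : (1 / (N : ℝ)) • ∑ n ∈ Finset.range N, x n - y
      = (1 / (N : ℝ)) • ∑ n ∈ Finset.range N, (x n - y) := by
    rw [Finset.sum_sub_distrib, smul_sub, Finset.sum_const, Finset.card_range,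
      ← Nat.cast_smul_eq_nsmul ℝ, smul_smul, one_div_mul_cancel hN', one_smul]
  rw [e, norm_smul, mul_pow, Real.norm_eq_abs, sq_abs]
  have h1 : ‖∑ n ∈ Finset.range N, (x n - y)‖ ^ 2 ≤ (∑ n ∈ Finset.range N, ‖x n - y‖) ^ 2 :=
    pow_le_pow_left₀ (norm_nonneg _) (norm_sum_le _ _) 2
  have h2 := sq_sum_le_card_mul_sum_sq (s := Finset.range N) (f := fun n => ‖x n - y‖)
  rw [Finset.card_range] at h2
  calc _ ≤ (1 / (N : ℝ)) ^ 2 * (N * ∑ n ∈ Finset.range N, ‖x n - y‖ ^ 2) :=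
        mul_le_mul_of_nonneg_left (h1.trans h2) (sq_nonneg _)
    _ = _ := by field_simp

/-- Telescoping for step sizes `1 / (lam t)` under strong convexity. -/
lemma sum_regret_le {lam G : ℝ} (hlam : 0 < lam) {a δ : ℕ → ℝ} {T N : ℕ}
    (h : ∀ n < N, δ (n + 1) ≤ δ n - 2 / (lam * ((T + n + 1 : ℕ) : ℝ)) * a n
      + (1 / (lam * ((T + n + 1 : ℕ) : ℝ))) ^ 2 * G ^ 2) :
    ∑ n ∈ Finset.range N, (a n - lam / 2 * δ n) + lam / 2 * (T + N) * δ N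
      ≤ lam / 2 * T * δ 0
        + G ^ 2 / (2 * lam) * ∑ n ∈ Finset.range N, 1 / ((T + n + 1 : ℕ) : ℝ) := by
  induction N with
  | zero => simp
  | succ N ih =>
    have h1 := ih fun n hn => h n (by omega)
    have h2 := h N (by omega)
    have ht : (0 : ℝ) < ((T + N + 1 : ℕ) : ℝ) := by positivity
    rw [Finset.sum_range_succ, Finset.sum_range_succ, mul_add]
    -- Weighting by `lam t / 2` with `t = T + N + 1` makes the coefficient of `a N` equal to `1`;
    -- the term `lam / 2 * δ N` lowers the weight of `δ N` to `lam (t - 1) / 2`, which is what the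
    -- induction hypothesis carries.
    have h3 := mul_le_mul_of_nonneg_left h2 (by positivity : 0 ≤ lam / 2 * ((T + N + 1 : ℕ) : ℝ))
    have e : lam / 2 * ((T + N + 1 : ℕ) : ℝ) * (δ N - 2 / (lam * ((T + N + 1 : ℕ) : ℝ)) * a N
        + (1 / (lam * ((T + N + 1 : ℕ) : ℝ))) ^ 2 * G ^ 2)
        = lam / 2 * ((T + N + 1 : ℕ) : ℝ) * δ N - a N
          + G ^ 2 / (2 * lam) * (1 / ((T + N + 1 : ℕ) : ℝ)) := by
      field_simp
    rw [e] at h3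
    push_cast at h3 h1 ⊢
    linarith

section Simplex

variable [Nonempty (Fin m)]

lemma secondPhase_p_pos (n : ℕ) (k : Fin m) : 0 < (secondPhase P O H D n).val.p k := by
  induction n generalizing k with
  | zero =>
    have : 0 < m := Fin.pos_iff_nonempty.2 ‹_›
    rw [secondPhase_zero_p]
    positivity
  | succ n ih =>
    rw [secondPhase_succ_p]
    exact pUpdate_pos ih _ _

lemma sum_secondPhase_p (n : ℕ) : ∑ k, (secondPhase P O H D n).val.p k = 1 := by
  cases n with
  | zero =>
    have : 0 < m := Fin.pos_iff_nonempty.2 ‹_›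
    have : (m : ℝ) ≠ 0 := by positivity
    simp [secondPhase_zero_p, this]
  | succ n =>
    rw [secondPhase_succ_p]
    exact sum_pUpdate (secondPhase_p_pos n) _

lemma secondPhase_p_le_one (n : ℕ) (k : Fin m) : (secondPhase P O H D n).val.p k ≤ 1 := by
  rw [← sum_secondPhase_p (P := P) (O := O) (H := H) (D := D) n]
  exact Finset.single_le_sum (fun i _ => (secondPhase_p_pos n i).le) (Finset.mem_univ k)

omit [Nonempty (Fin m)] in
lemma crossEntropy_secondPhase_zero {q : Fin m → ℝ} (hq : q ∈ stdSimplex ℝ (Fin m)) :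
    crossEntropy q (secondPhase P O H D 0).val.p = Real.log m := by
  simp only [crossEntropy, secondPhase_zero_p, ← Finset.sum_mul, hq.2]
  simp

end Simplex

end Trajectory

/-! ### Regret of the iterates and drift of the memory along one execution. -/

section Pathwise

variable {d m : ℕ} (P : Problem d m) (O : Oracle d m) (H : Hyper) (D : Draws d m)

/-- The subgradient used in the first phase at `w^(n+1)`. -/
noncomputable def firstDir (n : ℕ) : Vec d :=
  D.sg (n + 1) + H.γ •
    O.grad (O.sel fun i => P.g i (firstPhase P O H D n).val) (firstPhase P O H D n).val

/-- The subgradient used in the second phase at `w^(T₁+n+1)`. -/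
noncomputable def secondDir (n : ℕ) : Vec d :=
  D.sg (H.T₁ + n + 1) + H.γ • O.grad (D.i (H.T₁ + n + 1)) (secondPhase P O H D n).val.w

/-- The error of the remembered value of the `k`-th constraint. -/
noncomputable def memErr (n : ℕ) (k : Fin m) : ℝ :=
  P.gpos k (secondPhase P O H D n).val.w - (secondPhase P O H D n).val.mu k

variable {P O H D} {lam Lf Lg rho Gf Gg : ℝ} {wstar : Vec d} (hP : P.Admissible lam Lf Lg rho)
  (hs : wstar ∈ P.feasible) (hO : O.Valid P Gg) (h0 : D.w₁ ∈ P.W) (hT : 0 < H.T₁)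
  (hγ : 0 < H.γ) (hlam : 0 < H.lam)
  (hsg : ∀ t, 1 ≤ t → t ≤ H.T₁ + H.T₂ → ‖D.sg t‖ ≤ Gf)

include hO hγ in
lemma norm_add_grad_le {v w : Vec d} (hv : ‖v‖ ≤ Gf) (hw : w ∈ P.W) (i : Fin m) :
    ‖v + H.γ • O.grad i w‖ ≤ Gf + H.γ * Gg := by
  refine (norm_add_le _ _).trans (add_le_add hv ?_)
  rw [norm_smul, Real.norm_eq_abs, abs_of_pos hγ]
  exact mul_le_mul_of_nonneg_left (hO.norm_le i w hw) hγ.le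

include hP hs hO h0 hγ hsg

lemma norm_firstDir_le {n : ℕ} (hn : n < H.T₁) : ‖firstDir P O H D n‖ ≤ Gf + H.γ * Gg :=
  norm_add_grad_le hO hγ (hsg _ (by omega) (by omega)) (firstPhase_mem hP hs h0 n) _

include hT in
lemma norm_secondDir_le {n : ℕ} (hn : n < H.T₂) : ‖secondDir P O H D n‖ ≤ Gf + H.γ * Gg :=
  norm_add_grad_le hO hγ (hsg _ (by omega) (by omega)) (secondPhase_w_mem hP hs h0 hT n) _

include hlam

lemma sum_firstDir_le :
    ∑ n ∈ Finset.range H.T₁, (inner ℝ (firstDir P O H D n) ((firstPhase P O H D n).val - wstar)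
        - H.lam / 2 * ‖(firstPhase P O H D n).val - wstar‖ ^ 2)
      ≤ (Gf + H.γ * Gg) ^ 2 / (2 * H.lam) * ∑ n ∈ Finset.range H.T₁, 1 / ((n + 1 : ℕ) : ℝ) := by
  have h := sum_regret_le hlam (G := Gf + H.γ * Gg) (T := 0) (N := H.T₁)
    (a := fun n => inner ℝ (firstDir P O H D n) ((firstPhase P O H D n).val - wstar))
    (δ := fun n => ‖(firstPhase P O H D n).val - wstar‖ ^ 2) fun n hn => by
      rw [zero_add]
      refine (norm_wUpdate_sub_sq_le hP hs (n + 1) _ _).trans ?_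
      exact add_le_add le_rfl (mul_le_mul_of_nonneg_left (pow_le_pow_left₀ (norm_nonneg _)
        (norm_firstDir_le hP hs hO h0 hγ hsg hn) 2) (sq_nonneg _))
  simp only [zero_add, Nat.cast_zero, mul_zero, zero_mul] at h
  have : 0 ≤ H.lam / 2 * H.T₁ * ‖(firstPhase P O H D H.T₁).val - wstar‖ ^ 2 := by positivity
  linarith

include hT

lemma sum_secondDir_le :
    ∑ n ∈ Finset.range H.T₂,
        (inner ℝ (secondDir P O H D n) ((secondPhase P O H D n).val.w - wstar)
        - H.lam / 2 * ‖(secondPhase P O H D n).val.w - wstar‖ ^ 2)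
      ≤ H.lam / 2 * H.T₁ * ‖firstAverage P O H D - wstar‖ ^ 2
        + (Gf + H.γ * Gg) ^ 2 / (2 * H.lam)
          * ∑ n ∈ Finset.range H.T₂, 1 / ((H.T₁ + n + 1 : ℕ) : ℝ) := by
  have h := sum_regret_le hlam (G := Gf + H.γ * Gg) (T := H.T₁) (N := H.T₂)
    (a := fun n => inner ℝ (secondDir P O H D n) ((secondPhase P O H D n).val.w - wstar))
    (δ := fun n => ‖(secondPhase P O H D n).val.w - wstar‖ ^ 2) fun n hn => by
      refine (norm_wUpdate_sub_sq_le hP hs (H.T₁ + n + 1) _ _).trans ?_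
      exact add_le_add le_rfl (mul_le_mul_of_nonneg_left (pow_le_pow_left₀ (norm_nonneg _)
        (norm_secondDir_le hP hs hO h0 hT hγ hsg hn) 2) (sq_nonneg _))
  have : 0 ≤ H.lam / 2 * (H.T₁ + H.T₂)
    * ‖(secondPhase P O H D H.T₂).val.w - wstar‖ ^ 2 := by positivity
  simp only [secondPhase_zero_w] at h
  linarith

/-- The remembered values age by at most the length of a step. -/
lemma memErr_succ_sq_le (hm : 0 < m) (hLg : 0 < Lg) {n : ℕ} (hn : n < H.T₂) (k : Fin m) :
    memErr P O H D (n + 1) k ^ 2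
      ≤ (1 + 1 / (2 * m)) * (if D.j (H.T₁ + n + 1) = k then 0 else memErr P O H D n k ^ 2)
        + (1 + 2 * m) * (Lg * ((Gf + H.γ * Gg) / (H.lam * H.T₁))) ^ 2 := by
  have hw := secondPhase_w_mem hP hs h0 hT (O := O) n
  have hw' := secondPhase_w_mem hP hs h0 hT (O := O) (n + 1)
  have h1 := hP.gpos_lipschitz k hw' hw
  have h2 : ‖(secondPhase P O H D (n + 1)).val.w - (secondPhase P O H D n).val.w‖
      ≤ (Gf + H.γ * Gg) / (H.lam * H.T₁) := by
    refine (norm_wUpdate_sub_le hP hs hlam _ hw _).trans ?_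
    have hd := norm_secondDir_le hP hs hO h0 hT hγ hsg hn
    have hG : 0 ≤ Gf + H.γ * Gg := (norm_nonneg _).trans hd
    rw [div_eq_mul_one_div (Gf + H.γ * Gg), mul_comm (Gf + H.γ * Gg)]
    have hT' : (0 : ℝ) < H.T₁ := by positivity
    refine mul_le_mul (one_div_le_one_div_of_le (by positivity) ?_) hd (norm_nonneg _)
      (by positivity)
    push_cast
    gcongr
    linarith [Nat.cast_nonneg (α := ℝ) n]
  set r := Lg * ((Gf + H.γ * Gg) / (H.lam * H.T₁)) with hr
  have h3 : |P.gpos k (secondPhase P O H D (n + 1)).val.w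
      - P.gpos k (secondPhase P O H D n).val.w| ≤ r := by
    exact h1.trans (mul_le_mul_of_nonneg_left h2 hLg.le)
  set c := P.gpos k (secondPhase P O H D (n + 1)).val.w
      - P.gpos k (secondPhase P O H D n).val.w with hc
  have h4 : c ^ 2 ≤ r ^ 2 := sq_le_sq.2 (h3.trans (le_abs_self _))
  have hm' : (0 : ℝ) < m := by positivity
  -- Young's inequality; the growth `1 / (2m)` is half the probability that an entry is refreshed,
  -- so a contraction survives in expectation.
  have h5 : ∀ e : ℝ, (c + e) ^ 2 ≤ (1 + 1 / (2 * m)) * e ^ 2 + (1 + 2 * m) * r ^ 2 := by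
    intro e
    have h6 : (1 + 1 / (2 * (m : ℝ))) * e ^ 2 + (1 + 2 * m) * c ^ 2 - (c + e) ^ 2
        = (e - 2 * m * c) ^ 2 / (2 * m) := by
      field_simp
      ring
    have h7 : 0 ≤ (e - 2 * m * c) ^ 2 / (2 * m) := by positivity
    have h8 : (1 + 2 * (m : ℝ)) * c ^ 2 ≤ (1 + 2 * m) * r ^ 2 :=
      mul_le_mul_of_nonneg_left h4 (by positivity)
    linarith
  -- A refreshed entry stores the value at the iterate before the step, so its new error is the
  -- drift `c` and not zero.
  have h9 : memErr P O H D (n + 1) k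
      = c + if D.j (H.T₁ + n + 1) = k then 0 else memErr P O H D n k := by
    simp only [memErr, secondPhase_succ_mu, hc]
    split_ifs <;> ring
  rw [h9]
  refine (h5 _).trans (le_of_eq ?_)
  split_ifs <;> simp

end Pathwise

/-! ### Regret of the distributions along one execution. -/

section Weights

variable {d m : ℕ} {P : Problem d m} {O : Oracle d m} {H : Hyper} {D : Draws d m}
  {lam Lf Lg rho : ℝ} {wstar : Vec d}

/-- The regret of the distributions of the second phase. -/
lemma sum_pGradient_le [Nonempty (Fin m)] (hP : P.Admissible lam Lf Lg rho)
    (hs : wstar ∈ P.feasible) (h0 : D.w₁ ∈ P.W) (hT : 0 < H.T₁) (hγ : 0 < H.γ) (hlam : 0 < H.lam)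
    (hLg : 0 < Lg) (hη : H.η = H.lam / (2 * H.γ ^ 2 * Lg ^ 2)) {q : Fin m → ℝ}
    (hq : q ∈ stdSimplex ℝ (Fin m)) (N : ℕ) :
    ∑ n ∈ Finset.range N, ∑ k, (q k - (secondPhase P O H D n).val.p k)
        * pGradient H (secondPhase P O H D n).val.mu (D.j (H.T₁ + n + 1))
          (P.gpos (D.j (H.T₁ + n + 1)) (secondPhase P O H D n).val.w) k
      ≤ 2 * H.γ ^ 2 * Lg ^ 2 * Real.log m / H.lam
        + ∑ n ∈ Finset.range N, (H.lam / 8 * ‖(secondPhase P O H D n).val.w - wstar‖ ^ 2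
          + H.lam / Lg ^ 2 * (∑ k, memErr P O H D n k ^ 2
            + m ^ 2 * memErr P O H D n (D.j (H.T₁ + n + 1)) ^ 2)) := by
  have hη0 : 0 < H.η := by rw [hη]; positivity
  have hstep : ∀ n, H.η * ∑ k, (q k - (secondPhase P O H D n).val.p k)
        * pGradient H (secondPhase P O H D n).val.mu (D.j (H.T₁ + n + 1))
          (P.gpos (D.j (H.T₁ + n + 1)) (secondPhase P O H D n).val.w) k
      ≤ crossEntropy q (secondPhase P O H D n).val.p
        - crossEntropy q (secondPhase P O H D (n + 1)).val.p
        + H.η * (H.lam / 8 * ‖(secondPhase P O H D n).val.w - wstar‖ ^ 2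
          + H.lam / Lg ^ 2 * (∑ k, memErr P O H D n k ^ 2
            + m ^ 2 * memErr P O H D n (D.j (H.T₁ + n + 1)) ^ 2)) := by
    intro n
    have h := regret_pGradient_le (H := H) (mu := (secondPhase P O H D n).val.mu)
      (x := fun k => P.gpos k (secondPhase P O H D n).val.w) hq
      (secondPhase_p_pos (P := P) (O := O) (H := H) (D := D) n) (sum_secondPhase_p n) hη0.le hγ.le
      (fun k => ⟨gpos_nonneg _ _, hP.gpos_le hs k (secondPhase_w_mem hP hs h0 hT n)⟩)
      (D.j (H.T₁ + n + 1))
    rw [secondPhase_succ_p]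
    refine h.trans (le_of_eq ?_)
    simp only [memErr]
    congr 1
    -- With `B = Lg ‖w - wstar‖` the chosen step size satisfies `η γ² Lg² / 4 = lam / 8` and `2 η γ²
    -- = lam / Lg²`.
    rw [sq, mul_assoc, hη]
    field_simp
    ring
  have hsum := Finset.sum_le_sum fun n (_ : n ∈ Finset.range N) => hstep n
  rw [← Finset.mul_sum, Finset.sum_add_distrib, Finset.sum_range_sub', ← Finset.mul_sum,
    crossEntropy_secondPhase_zero hq] at hsum
  have hN := crossEntropy_nonneg (q := q) hq.1
    ⟨fun k => (secondPhase_p_pos (P := P) (O := O) (H := H) (D := D) N k).le, sum_secondPhase_p N⟩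
  have e : 2 * H.γ ^ 2 * Lg ^ 2 * Real.log m / H.lam = Real.log m / H.η := by
    rw [hη]; field_simp
  rw [e, ← sub_nonneg]
  refine nonneg_of_mul_nonneg_right (a := H.η) ?_ hη0
  rw [mul_sub, mul_add, mul_div_cancel₀ _ hη0.ne']
  linarith

end Weights

/-! ### Bounded measurable functions and conditional expectations. -/

section MeasureTools

section Plain

variable {Ω : Type*} {mΩ : MeasurableSpace Ω}

lemma measurable_pi_fun {ι β : Type*} [MeasurableSpace β] {c : ι → Ω → β}
    (h : ∀ i, Measurable (c i)) : Measurable fun ω i => c i ω := measurable_pi_lambda _ h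

lemma measurable_sum_range {d : ℕ} {c : ℕ → Ω → Vec d} {N : ℕ}
    (h : ∀ n < N, Measurable (c n)) (a : ℝ) :
    Measurable fun ω => a • ∑ n ∈ Finset.range N, c n ω :=
  (Finset.measurable_fun_sum _ fun n hn => h n (Finset.mem_range.1 hn)).const_smul a

lemma measurable_sum_univ {m : ℕ} {c : Fin m → Ω → ℝ} (h : ∀ k, Measurable (c k)) :
    Measurable fun ω => ∑ k, c k ω := Finset.measurable_fun_sum _ fun k _ => h k

end Plain

variable {Ω : Type*}

/-- Bounded measurable real functions. -/
structure BddMeas (m' : MeasurableSpace Ω) (φ : Ω → ℝ) : Prop where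
  meas : Measurable[m'] φ
  bdd : ∃ C, ∀ ω, |φ ω| ≤ C

namespace BddMeas

variable {m' m'' : MeasurableSpace Ω} {φ ψ : Ω → ℝ}

lemma const (c : ℝ) : BddMeas m' fun _ => c := ⟨measurable_const, |c|, fun _ => le_rfl⟩

lemma add (h : BddMeas m' φ) (h' : BddMeas m' ψ) : BddMeas m' fun ω => φ ω + ψ ω := by
  obtain ⟨C, hC⟩ := h.bdd
  obtain ⟨C', hC'⟩ := h'.bdd
  exact ⟨h.meas.add h'.meas, C + C', fun ω => (abs_add_le _ _).trans (add_le_add (hC ω) (hC' ω))⟩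

lemma mul (h : BddMeas m' φ) (h' : BddMeas m' ψ) : BddMeas m' fun ω => φ ω * ψ ω := by
  obtain ⟨C, hC⟩ := h.bdd
  obtain ⟨C', hC'⟩ := h'.bdd
  refine ⟨h.meas.mul h'.meas, C * C', fun ω => ?_⟩
  rw [abs_mul]
  exact mul_le_mul (hC ω) (hC' ω) (abs_nonneg _) ((abs_nonneg _).trans (hC ω))

lemma sub (h : BddMeas m' φ) (h' : BddMeas m' ψ) : BddMeas m' fun ω => φ ω - ψ ω := by
  simpa [sub_eq_add_neg] using h.add ((const (-1)).mul h')

lemma pow_two (h : BddMeas m' φ) : BddMeas m' fun ω => φ ω ^ 2 := by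
  simpa [sq] using h.mul h

lemma sum {ι : Type*} (s : Finset ι) {φ : ι → Ω → ℝ} (h : ∀ i, BddMeas m' (φ i)) :
    BddMeas m' fun ω => ∑ i ∈ s, φ i ω := by
  classical
  induction s using Finset.induction_on with
  | empty => simpa using const 0
  | insert a s ha ih => simpa [Finset.sum_insert ha] using (h a).add ih

lemma mono (h : BddMeas m' φ) (hm : m' ≤ m'') : BddMeas m'' φ := ⟨h.meas.mono hm le_rfl, h.bdd⟩

lemma indicator {m : ℕ} {j : Ω → Fin m} (hj : Measurable[m'] j) (k : Fin m) :
    BddMeas m' fun ω => if j ω = k then 1 else 0 := by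
  refine ⟨Measurable.ite (hj (measurableSet_singleton k)) measurable_const measurable_const, 1,
    fun ω => ?_⟩
  split_ifs <;> simp

lemma eval {m : ℕ} {j : Ω → Fin m} (hj : Measurable[m'] j) {c : Fin m → Ω → ℝ}
    (hc : ∀ k, BddMeas m' (c k)) : BddMeas m' fun ω => c (j ω) ω := by
  have e : (fun ω => c (j ω) ω) = fun ω => ∑ k, (if j ω = k then 1 else 0) * c k ω := by
    ext ω; simp
  rw [e]
  exact sum _ fun k => (indicator hj k).mul (hc k)

lemma integrable {μ : Measure[m'] Ω} [IsFiniteMeasure μ] (h : BddMeas m' φ) : Integrable φ μ := by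
  obtain ⟨C, hC⟩ := h.bdd
  exact Integrable.of_bound h.meas.aestronglyMeasurable C (ae_of_all _ hC)

end BddMeas

variable {m' mΩ : MeasurableSpace Ω} {μ : Measure Ω} [IsFiniteMeasure μ] {d m : ℕ}

/-- A bounded factor known to the past can be pulled out of the conditional expectation. -/
lemma integral_condExp_inner (hm : m' ≤ mΩ) {X Y : Ω → Vec d} (hX : Measurable[m'] X) {C : ℝ}
    (hXC : ∀ ω, ‖X ω‖ ≤ C) (hY : Integrable Y μ) :
    Integrable (fun ω => inner ℝ (Y ω) (X ω)) μ ∧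
      Integrable (fun ω => inner ℝ ((μ[Y | m']) ω) (X ω)) μ ∧
      ∫ ω, inner ℝ (Y ω) (X ω) ∂μ = ∫ ω, inner ℝ ((μ[Y | m']) ω) (X ω) ∂μ := by
  have hX' : AEStronglyMeasurable X μ := (hX.mono hm le_rfl).aestronglyMeasurable
  have hint : ∀ Z : Ω → Vec d, Integrable Z μ → Integrable (fun ω => inner ℝ (Z ω) (X ω)) μ := by
    intro Z hZ
    refine (hZ.norm.mul_const C).mono' (hZ.aestronglyMeasurable.inner hX')
      (ae_of_all _ fun ω => ?_)
    exact (norm_inner_le_norm _ _).trans (mul_le_mul_of_nonneg_left (hXC ω) (norm_nonneg _))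
  refine ⟨hint Y hY, hint _ integrable_condExp, ?_⟩
  have h := condExp_bilin_of_stronglyMeasurable_right (m := m') (μ := μ)
    (innerSL ℝ (E := Vec d)) hX.stronglyMeasurable (hint Y hY) hY
  rw [← integral_condExp hm]
  exact integral_congr_ae h

/-- Expand `c (j ω) ω` into indicators of `j = k` and pull out each coefficient, known to the past.
This serves both the index drawn from `p` and the uniform one. -/
lemma integral_condExp_index (hm : m' ≤ mΩ) {j : Ω → Fin m} (hj : Measurable j)
    {c q : Fin m → Ω → ℝ} (hc : ∀ k, BddMeas m' (c k))
    (hq : ∀ k, ∀ᵐ ω ∂μ, (μ[fun ω' => if j ω' = k then (1 : ℝ) else 0 | m']) ω = q k ω) :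
    ∫ ω, c (j ω) ω ∂μ = ∫ ω, ∑ k, q k ω * c k ω ∂μ := by
  have e : (fun ω => c (j ω) ω) = fun ω => ∑ k, (if j ω = k then 1 else 0) * c k ω := by
    ext ω; simp
  have hI : ∀ k, Integrable (fun ω => (if j ω = k then (1 : ℝ) else 0) * c k ω) μ := fun k =>
    ((BddMeas.indicator hj k).mul ((hc k).mono hm)).integrable
  have hJ : ∀ k, Integrable (fun ω => if j ω = k then (1 : ℝ) else 0) μ := fun k =>
    (BddMeas.indicator hj k).integrable
  have h : ∀ k, μ[fun ω => (if j ω = k then (1 : ℝ) else 0) * c k ω | m']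
      =ᵐ[μ] fun ω => q k ω * c k ω := by
    intro k
    have h1 := condExp_mul_of_stronglyMeasurable_right (m := m') (μ := μ)
      (hc k).meas.stronglyMeasurable (hI k) (hJ k)
    filter_upwards [h1, hq k] with ω hω hω'
    refine hω.trans ?_
    rw [Pi.mul_apply, hω']
  rw [e, integral_finsetSum _ fun k _ => hI k, integral_finsetSum _ fun k _ =>
    (integrable_congr (h k)).1 integrable_condExp]
  refine Finset.sum_congr rfl fun k _ => ?_
  rw [← integral_condExp hm]
  exact integral_congr_ae (h k)

/-- The objective and the constraints are controlled only on the domain, so measurability passes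
through the subtype. -/
lemma measurable_comp_of_continuousOn {β : Type*} [TopologicalSpace β] [MeasurableSpace β]
    [BorelSpace β] {S : Set (Vec d)} {φ : Vec d → β} (hφ : ContinuousOn φ S) {X : Ω → Vec d}
    (hX : Measurable[m'] X) (hXS : ∀ ω, X ω ∈ S) : Measurable[m'] fun ω => φ (X ω) :=
  (continuousOn_iff_continuous_domRestrict.1 hφ).measurable.comp (hX.subtype_mk (h := hXS))

lemma measurable_eval_fin {β : Type*} [MeasurableSpace β] {j : Ω → Fin m} (hj : Measurable[m'] j)
    {c : Fin m → Ω → β} (hc : ∀ k, Measurable[m'] (c k)) : Measurable[m'] fun ω => c (j ω) ω := by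
  have h : Measurable (fun x : Fin m × Ω => c x.1 x.2) := measurable_from_prod_countable_right hc
  exact h.comp (hj.prodMk measurable_id)

end MeasureTools

/-! ### Adaptedness of the iterates to the filtration. -/

section Adapted

variable {d m : ℕ} {Ω : Type*} {mΩ : MeasurableSpace Ω} {μ : Measure Ω} {F : Filtration ℕ mΩ}
  {P : Problem d m} {O : Oracle d m} {H : Hyper} {Gf Gg : ℝ} {D : Ω → Draws d m}
  {lam Lf Lg rho : ℝ} {wstar : Vec d} (hrun : IsRun μ F P O H Gf D)
  (hP : P.Admissible lam Lf Lg rho) (hs : wstar ∈ P.feasible) (hO : O.Valid P Gg)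

include hP hs in
lemma measurable_wUpdate {m' : MeasurableSpace Ω} {t : ℕ} {w v : Ω → Vec d}
    (hsg : Measurable[m'] fun ω => (D ω).sg t) (hw : Measurable[m'] w) (hv : Measurable[m'] v) :
    Measurable[m'] fun ω => wUpdate P H (D ω) t (w ω) (v ω) := by
  unfold wUpdate
  refine (continuous_proj ⟨_, hs.1⟩ hP.closed hP.convex).measurable.comp ?_
  have h1 : Measurable[m'] fun ω => (D ω).sg t + H.γ • v ω := hsg.add (hv.const_smul H.γ)
  have h2 : Measurable[m'] fun ω => (1 / (H.lam * t)) • ((D ω).sg t + H.γ • v ω) :=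
    h1.const_smul (1 / (H.lam * t))
  exact hw.sub h2

include hO in
lemma measurable_grad_comp {m' : MeasurableSpace Ω} {i : Ω → Fin m} {w : Ω → Vec d}
    (hi : Measurable[m'] i) (hw : Measurable[m'] w) :
    Measurable[m'] fun ω => O.grad (i ω) (w ω) :=
  measurable_eval_fin hi fun k => (hO.measurable_grad k).comp hw

include hrun hP hs hO

lemma measurable_firstPhase {n : ℕ} (hn : n ≤ H.T₁) :
    Measurable[F n] fun ω => (firstPhase P O H (D ω) n).val := by
  induction n with
  | zero => exact hrun.init_meas
  | succ n ih =>
    have hw : Measurable[F n] fun ω => (firstPhase P O H (D ω) n).val := ih (by omega)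
    have hw' := hw.mono (F.mono n.le_succ) le_rfl
    simp only [firstPhase_succ]
    refine measurable_wUpdate hP hs (hrun.sg_meas _ (by omega) (by omega)) hw'
      (measurable_grad_comp hO (hO.measurable_sel.comp (measurable_pi_fun fun i => ?_)) hw')
    exact measurable_comp_of_continuousOn (continuousOn_of_lipschitz (hP.lipschitz_g i)) hw'
      fun ω => firstPhase_mem hP hs (hrun.init_mem ω) n

lemma measurable_firstAverage : Measurable[F H.T₁] fun ω => firstAverage P O H (D ω) := by
  unfold firstAverage
  refine measurable_sum_range (fun n hn => ?_) _
  exact (measurable_firstPhase hrun hP hs hO hn.le).mono (F.mono hn.le) le_rfl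

lemma measurable_secondPhase (hT : 0 < H.T₁) {n : ℕ} (hn : n ≤ H.T₂) :
    Measurable[F (H.T₁ + n)] (fun ω => (secondPhase P O H (D ω) n).val.w) ∧
    (∀ k, Measurable[F (H.T₁ + n)] fun ω => (secondPhase P O H (D ω) n).val.p k) ∧
    ∀ k, Measurable[F (H.T₁ + n)] fun ω => (secondPhase P O H (D ω) n).val.mu k := by
  induction n with
  | zero =>
    refine ⟨measurable_firstAverage hrun hP hs hO, fun k => measurable_const, fun k => ?_⟩
    exact measurable_comp_of_continuousOn (hP.continuousOn_gpos k)
      (measurable_firstAverage hrun hP hs hO) fun ω => firstAverage_mem hP hs (hrun.init_mem ω) hT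
  | succ n ih =>
    obtain ⟨hw, hp, hmu⟩ := ih (by omega)
    have hle : F (H.T₁ + n) ≤ F (H.T₁ + (n + 1)) := F.mono (by omega)
    replace hw := hw.mono hle le_rfl
    replace hp := fun k => (hp k).mono hle le_rfl
    replace hmu := fun k => (hmu k).mono hle le_rfl
    have hx : ∀ k, Measurable[F (H.T₁ + (n + 1))]
        fun ω => P.gpos k (secondPhase P O H (D ω) n).val.w := fun k =>
      measurable_comp_of_continuousOn (hP.continuousOn_gpos k) hw
        fun ω => secondPhase_w_mem hP hs (hrun.init_mem ω) hT n
    have hj := hrun.j_meas (H.T₁ + n + 1) (by omega) (by omega)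
    have hjk : ∀ k, MeasurableSet[F (H.T₁ + (n + 1))] {ω | (D ω).j (H.T₁ + n + 1) = k} :=
      fun k => hj (measurableSet_singleton k)
    refine ⟨?_, fun k => ?_, fun k => ?_⟩
    · simp only [secondPhase_succ_w]
      exact measurable_wUpdate hP hs (hrun.sg_meas _ (by omega) (by omega)) hw
        (measurable_grad_comp hO (hrun.i_meas _ (by omega) (by omega)) hw)
    · have hq : ∀ k, Measurable[F (H.T₁ + (n + 1))] fun ω =>
          Real.exp (Real.log ((secondPhase P O H (D ω) n).val.p k) + H.η *
            pGradient H (secondPhase P O H (D ω) n).val.mu ((D ω).j (H.T₁ + n + 1))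
              (P.gpos ((D ω).j (H.T₁ + n + 1)) (secondPhase P O H (D ω) n).val.w) k) := by
        intro k
        have e := fun ω => pGradient_apply (H := H) (secondPhase P O H (D ω) n).val.mu
          (fun l => P.gpos l (secondPhase P O H (D ω) n).val.w) ((D ω).j (H.T₁ + n + 1)) k
        simp only [e]
        refine Real.measurable_exp.comp ((Real.measurable_log.comp (hp k)).add
          (Measurable.const_mul (((hmu k).const_mul _).add (Measurable.ite (hjk k) ?_
            measurable_const)) _))
        exact ((hx k).sub (hmu k)).const_mul _
      simp only [secondPhase_succ_p, pUpdate]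
      refine (hq k).div (measurable_sum_univ fun l => ?_)
      exact continuous_abs.measurable.comp (hq l)
    · simp only [secondPhase_succ_mu]
      exact Measurable.ite (hjk k) (hx k) (hmu k)

end Adapted

/-! ### Expected progress in the first phase. -/

section Expectation

variable {d m : ℕ} {Ω : Type*} {mΩ : MeasurableSpace Ω} {μ : Measure Ω} [IsProbabilityMeasure μ]
  {F : Filtration ℕ mΩ} {P : Problem d m} {O : Oracle d m} {H : Hyper} {Gf Gg : ℝ}
  {D : Ω → Draws d m} {Lf Lg rho : ℝ} {wstar : Vec d} (hrun : IsRun μ F P O H Gf D)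
  (hP : P.Admissible H.lam Lf Lg rho) (hs : wstar ∈ P.feasible) (hO : O.Valid P Gg)
  (hT : 0 < H.T₁) (hγ : 0 < H.γ)

omit [IsProbabilityMeasure μ] in
include hP in
lemma bddMeas_comp {m' : MeasurableSpace Ω} {φ : Vec d → ℝ} (hφ : ContinuousOn φ P.W)
    {w : Ω → Vec d} (hw : Measurable[m'] w) (hwW : ∀ ω, w ω ∈ P.W) :
    BddMeas m' fun ω => φ (w ω) := by
  obtain ⟨C, hC⟩ := (Metric.isCompact_of_isClosed_isBounded hP.closed
    hP.bounded).exists_bound_of_continuousOn hφ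
  exact ⟨measurable_comp_of_continuousOn hφ hw hwW, C, fun ω => hC _ (hwW ω)⟩

include hP in
lemma bddMeas_norm_sub_sq {m' : MeasurableSpace Ω} {w : Ω → Vec d} (hw : Measurable[m'] w)
    (hwW : ∀ ω, w ω ∈ P.W) : BddMeas m' fun ω => ‖w ω - wstar‖ ^ 2 :=
  bddMeas_comp hP (φ := fun w => ‖w - wstar‖ ^ 2) (by fun_prop) hw hwW

include hP hO in
lemma bddMeas_inner_grad {m' : MeasurableSpace Ω} {i : Ω → Fin m} {w : Ω → Vec d}
    (hi : Measurable[m'] i) (hw : Measurable[m'] w) (hwW : ∀ ω, w ω ∈ P.W) :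
    BddMeas m' fun ω => inner ℝ (O.grad (i ω) (w ω)) (w ω - wstar) := by
  obtain ⟨C, hC⟩ := (bddMeas_comp hP (φ := fun w => ‖w - wstar‖) (by fun_prop) hw hwW).bdd
  refine ⟨(measurable_grad_comp hO hi hw).inner (hw.sub_const _), Gg * C, fun ω => ?_⟩
  refine (abs_real_inner_le_norm _ _).trans ?_
  have := hC ω
  rw [abs_norm] at this
  exact mul_le_mul (hO.norm_le _ _ (hwW ω)) this (norm_nonneg _)
    ((norm_nonneg _).trans (hO.norm_le (i ω) _ (hwW ω)))

include hP hs in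
/-- The expected progress of a stochastic subgradient of the objective. -/
lemma integral_inner_subgradient_ge {m' : MeasurableSpace Ω} (hm' : m' ≤ mΩ) {w Y : Ω → Vec d}
    (hw : Measurable[m'] w) (hwW : ∀ ω, w ω ∈ P.W) (hY : Integrable Y μ)
    (hsub : ∀ᵐ ω ∂μ, IsSubgradient P.W P.f (w ω) ((μ[Y | m']) ω)) :
    Integrable (fun ω => inner ℝ (Y ω) (w ω - wstar)) μ ∧
      ∫ ω, (P.f (w ω) - P.f wstar + H.lam / 2 * ‖w ω - wstar‖ ^ 2) ∂μ
        ≤ ∫ ω, inner ℝ (Y ω) (w ω - wstar) ∂μ := by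
  obtain ⟨C, hC⟩ := (bddMeas_comp hP (φ := fun w => ‖w - wstar‖) (by fun_prop) hw hwW).bdd
  simp only [abs_norm] at hC
  obtain ⟨h1, h2, h3⟩ := integral_condExp_inner (μ := μ) hm' (hw.sub_const wstar) hC hY
  refine ⟨h1, ?_⟩
  rw [h3]
  have hB : BddMeas m' fun ω => P.f (w ω) - P.f wstar + H.lam / 2 * ‖w ω - wstar‖ ^ 2 :=
    ((bddMeas_comp hP hP.continuousOn_f hw hwW).sub (.const _)).add
      ((BddMeas.const _).mul (bddMeas_norm_sub_sq hP hw hwW))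
  refine integral_mono_ae (hB.mono hm').integrable h2 ?_
  filter_upwards [hsub] with ω hω
  have := hω.strong hP.strongConvex (hwW ω) hs.1
  rw [← neg_sub (w ω) wstar, inner_neg_right, norm_neg] at this
  linarith

include hO hs in
-- The subgradient inequality tested at `wstar`, where the positive part vanishes.
lemma gpos_le_inner_grad (k : Fin m) {w : Vec d} (hw : w ∈ P.W) :
    P.gpos k w ≤ inner ℝ (O.grad k w) (w - wstar) := by
  have h : P.gpos k w + inner ℝ (O.grad k w) (wstar - w) ≤ P.gpos k wstar :=
    hO.subgradient k w hw wstar hs.1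
  rw [gpos_eq_zero hs, ← neg_sub w wstar, inner_neg_right] at h
  linarith

include hrun

omit [IsProbabilityMeasure μ] in
lemma ae_norm_sg_le :
    ∀ᵐ ω ∂μ, ∀ t, 1 ≤ t → t ≤ H.T₁ + H.T₂ → ‖(D ω).sg t‖ ≤ Gf := by
  rw [ae_all_iff]
  intro t
  by_cases h : 1 ≤ t ∧ t ≤ H.T₁ + H.T₂
  · filter_upwards [hrun.sg_bound t h.1 h.2] with ω hω _ _ using hω
  · exact ae_of_all _ fun ω h1 h2 => absurd ⟨h1, h2⟩ h

lemma integrable_sg {t : ℕ} (h1 : 1 ≤ t) (h2 : t ≤ H.T₁ + H.T₂) :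
    Integrable (fun ω => (D ω).sg t) μ :=
  Integrable.of_bound ((hrun.sg_meas t h1 h2).mono (F.le t) le_rfl).aestronglyMeasurable Gf
    (hrun.sg_bound t h1 h2)

include hP hs hO

omit [IsProbabilityMeasure μ] in
lemma bddMeas_firstPhase {n : ℕ} (hn : n ≤ H.T₁) :
    BddMeas mΩ fun ω => ‖(firstPhase P O H (D ω) n).val - wstar‖ ^ 2 :=
  (bddMeas_norm_sub_sq hP (measurable_firstPhase hrun hP hs hO hn)
    fun ω => firstPhase_mem hP hs (hrun.init_mem ω) n).mono (F.le _)

include hγ in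
-- The full `lam` is the sum of two halves: one from strong convexity of `f` in its subgradient
-- inequality, one from the growth `hpen` of the penalized objective.
lemma integral_firstDir_ge [Nonempty (Fin m)] (hpen : ∀ w ∈ P.W, ∀ i, (∀ k, P.g k w ≤ P.g i w) →
      P.f wstar + H.lam / 2 * ‖w - wstar‖ ^ 2 ≤ P.f w + H.γ * P.gpos i w)
    {n : ℕ} (hn : n < H.T₁) :
    Integrable (fun ω => inner ℝ (firstDir P O H (D ω) n)
        ((firstPhase P O H (D ω) n).val - wstar)) μ ∧
      H.lam * ∫ ω, ‖(firstPhase P O H (D ω) n).val - wstar‖ ^ 2 ∂μ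
        ≤ ∫ ω, inner ℝ (firstDir P O H (D ω) n)
          ((firstPhase P O H (D ω) n).val - wstar) ∂μ := by
  set w : Ω → Vec d := fun ω => (firstPhase P O H (D ω) n).val with hwdef
  have hw : Measurable[F n] w := measurable_firstPhase hrun hP hs hO hn.le
  have hwW : ∀ ω, w ω ∈ P.W := fun ω => firstPhase_mem hP hs (hrun.init_mem ω) n
  obtain ⟨h1, h2⟩ := integral_inner_subgradient_ge (μ := μ) hP hs (F.le n) hw hwW
    (integrable_sg hrun (t := n + 1) (by omega) (by omega)) (hrun.sg_first n hn)
  set i : Ω → Fin m := fun ω => O.sel fun i => P.g i (w ω) with hidef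
  have hi : Measurable[F n] i := hO.measurable_sel.comp (measurable_pi_fun fun i =>
    measurable_comp_of_continuousOn (continuousOn_of_lipschitz (hP.lipschitz_g i)) hw hwW)
  have h3 := ((bddMeas_inner_grad (wstar := wstar) hP hO hi hw hwW).mono (F.le n)).integrable
    (μ := μ)
  have e : (fun ω => inner ℝ (firstDir P O H (D ω) n) (w ω - wstar)) = fun ω =>
      inner ℝ ((D ω).sg (n + 1)) (w ω - wstar)
        + H.γ * inner ℝ (O.grad (i ω) (w ω)) (w ω - wstar) := by
    ext ω
    simp only [firstDir, inner_add_left, real_inner_smul_left, hwdef, hidef]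
  rw [e]
  refine ⟨h1.add (h3.const_mul _), ?_⟩
  rw [integral_add h1 (h3.const_mul _), integral_const_mul]
  have hD := (bddMeas_firstPhase (wstar := wstar) hrun hP hs hO hn.le).integrable (μ := μ)
  have hfB := ((((bddMeas_comp hP hP.continuousOn_f hw hwW).sub (.const (P.f wstar))).add
      ((BddMeas.const (H.lam / 2)).mul (bddMeas_norm_sub_sq (wstar := wstar) hP hw hwW))).mono
        (F.le n)).integrable (μ := μ)
  refine le_trans ?_ (add_le_add_left h2 _)
  rw [← integral_const_mul, ← integral_const_mul, ← integral_add hfB (h3.const_mul _)]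
  refine integral_mono (hD.const_mul _) (hfB.add (h3.const_mul _)) fun ω => ?_
  have h4 := hpen (w ω) (hwW ω) (i ω) fun k => hO.sel_max (fun k => P.g k (w ω)) k
  have h5 := mul_le_mul_of_nonneg_left (gpos_le_inner_grad (O := O) hs hO (i ω) (hwW ω)) hγ.le
  change H.lam * ‖w ω - wstar‖ ^ 2
    ≤ P.f (w ω) - P.f wstar + H.lam / 2 * ‖w ω - wstar‖ ^ 2
      + H.γ * inner ℝ (O.grad (i ω) (w ω)) (w ω - wstar)
  linarith

include hγ in
/-- The guarantee of the first phase. -/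
lemma integral_firstAverage_le [Nonempty (Fin m)] (hlam : 0 < H.lam) (hT : 0 < H.T₁)
    (hpen : ∀ w ∈ P.W, ∀ i, (∀ k, P.g k w ≤ P.g i w) →
      P.f wstar + H.lam / 2 * ‖w - wstar‖ ^ 2 ≤ P.f w + H.γ * P.gpos i w) :
    H.lam / 2 * H.T₁ * ∫ ω, ‖firstAverage P O H (D ω) - wstar‖ ^ 2 ∂μ
      ≤ (Gf + H.γ * Gg) ^ 2 / (2 * H.lam)
        * ∑ n ∈ Finset.range H.T₁, 1 / ((n + 1 : ℕ) : ℝ) := by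
  have hD := fun n (hn : n ∈ Finset.range H.T₁) => (bddMeas_firstPhase (wstar := wstar) hrun hP hs
    hO (Finset.mem_range.1 hn).le).integrable (μ := μ)
  have hA := fun n (hn : n ∈ Finset.range H.T₁) => integral_firstDir_ge (wstar := wstar) (μ := μ)
    hrun hP hs hO hγ hpen (Finset.mem_range.1 hn)
  have hT' : (0 : ℝ) < H.T₁ := by positivity
  have h1 : ∫ ω, ‖firstAverage P O H (D ω) - wstar‖ ^ 2 ∂μ
      ≤ 1 / (H.T₁ : ℝ) * ∑ n ∈ Finset.range H.T₁,
        ∫ ω, ‖(firstPhase P O H (D ω) n).val - wstar‖ ^ 2 ∂μ := by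
    rw [← integral_finsetSum _ hD, ← integral_const_mul]
    refine integral_mono ((bddMeas_norm_sub_sq hP (measurable_firstAverage hrun hP hs hO)
      fun ω => firstAverage_mem hP hs (hrun.init_mem ω) hT).mono (F.le _)).integrable
      ((integrable_finsetSum _ hD).const_mul _) fun ω => norm_average_sub_sq_le hT
  have h2 : ∑ n ∈ Finset.range H.T₁, ∫ ω, (inner ℝ (firstDir P O H (D ω) n)
        ((firstPhase P O H (D ω) n).val - wstar)
        - H.lam / 2 * ‖(firstPhase P O H (D ω) n).val - wstar‖ ^ 2) ∂μ
      ≤ (Gf + H.γ * Gg) ^ 2 / (2 * H.lam)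
        * ∑ n ∈ Finset.range H.T₁, 1 / ((n + 1 : ℕ) : ℝ) := by
    have hI : ∀ n ∈ Finset.range H.T₁, Integrable (fun ω => inner ℝ (firstDir P O H (D ω) n)
        ((firstPhase P O H (D ω) n).val - wstar)
        - H.lam / 2 * ‖(firstPhase P O H (D ω) n).val - wstar‖ ^ 2) μ :=
      fun n hn => (hA n hn).1.sub ((hD n hn).const_mul _)
    rw [← integral_finsetSum _ hI]
    have h3 := integral_mono_ae (μ := μ) (integrable_finsetSum _ hI)
      (integrable_const ((Gf + H.γ * Gg) ^ 2 / (2 * H.lam)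
        * ∑ n ∈ Finset.range H.T₁, 1 / ((n + 1 : ℕ) : ℝ)))
      (by
        filter_upwards [ae_norm_sg_le hrun] with ω hω
        exact sum_firstDir_le (wstar := wstar) hP hs hO (hrun.init_mem ω) hγ hlam hω)
    simpa using h3
  have h4 : ∑ n ∈ Finset.range H.T₁,
        H.lam / 2 * ∫ ω, ‖(firstPhase P O H (D ω) n).val - wstar‖ ^ 2 ∂μ
      ≤ ∑ n ∈ Finset.range H.T₁, ∫ ω, (inner ℝ (firstDir P O H (D ω) n)
        ((firstPhase P O H (D ω) n).val - wstar)
        - H.lam / 2 * ‖(firstPhase P O H (D ω) n).val - wstar‖ ^ 2) ∂μ := by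
    refine Finset.sum_le_sum fun n hn => ?_
    rw [integral_sub (hA n hn).1 ((hD n hn).const_mul _), integral_const_mul]
    linarith [(hA n hn).2]
  rw [← Finset.mul_sum] at h4
  calc _ ≤ H.lam / 2 * H.T₁ * (1 / (H.T₁ : ℝ) * ∑ n ∈ Finset.range H.T₁,
        ∫ ω, ‖(firstPhase P O H (D ω) n).val - wstar‖ ^ 2 ∂μ) :=
        mul_le_mul_of_nonneg_left h1 (by positivity)
    _ = H.lam / 2 * ∑ n ∈ Finset.range H.T₁,
        ∫ ω, ‖(firstPhase P O H (D ω) n).val - wstar‖ ^ 2 ∂μ := by field_simp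
    _ ≤ _ := h4.trans h2

end Expectation

/-! ### Expected progress and memory error in the second phase. -/

section SecondPhase

variable {d m : ℕ} {Ω : Type*} {mΩ : MeasurableSpace Ω} {μ : Measure Ω} [IsProbabilityMeasure μ]
  {F : Filtration ℕ mΩ} {P : Problem d m} {O : Oracle d m} {H : Hyper} {Gf Gg : ℝ}
  {D : Ω → Draws d m} {Lf Lg rho : ℝ} {wstar : Vec d} (hrun : IsRun μ F P O H Gf D)
  (hP : P.Admissible H.lam Lf Lg rho) (hs : wstar ∈ P.feasible) (hO : O.Valid P Gg)
  (hT : 0 < H.T₁) (hγ : 0 < H.γ) (hlam : 0 < H.lam) (hLg : 0 < Lg)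

include hrun hP hs hO hT

section Bounded

omit [IsProbabilityMeasure μ]

variable {n : ℕ} (hn : n ≤ H.T₂)
include hn

lemma bddMeas_comp_secondPhase {φ : Vec d → ℝ} (hφ : ContinuousOn φ P.W) :
    BddMeas (F (H.T₁ + n)) fun ω => φ (secondPhase P O H (D ω) n).val.w :=
  bddMeas_comp hP hφ (measurable_secondPhase hrun hP hs hO hT hn).1
    fun ω => secondPhase_w_mem hP hs (hrun.init_mem ω) hT n

lemma bddMeas_mu (k : Fin m) :
    BddMeas (F (H.T₁ + n)) fun ω => (secondPhase P O H (D ω) n).val.mu k := by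
  refine ⟨(measurable_secondPhase hrun hP hs hO hT hn).2.2 k, ?_⟩
  have h : ∀ l : Fin m, ∃ C, ∀ w ∈ P.W, ‖P.gpos l w‖ ≤ C := fun l =>
    (Metric.isCompact_of_isClosed_isBounded hP.closed
      hP.bounded).exists_bound_of_continuousOn (hP.continuousOn_gpos l)
  choose C hC using h
  refine ⟨∑ l, C l, fun ω => ?_⟩
  have hc : ∀ l, ∀ w ∈ P.W, P.gpos l w ≤ ∑ l, C l := fun l w hw =>
    ((le_abs_self _).trans (hC l w hw)).trans (Finset.single_le_sum
      (fun i _ => (norm_nonneg _).trans (hC i _ hs.1)) (Finset.mem_univ l))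
  have := secondPhase_mu_mem (O := O) hP hs (hrun.init_mem ω) hT hc n k
  rw [abs_of_nonneg this.1]
  exact this.2

lemma bddMeas_memErr (k : Fin m) : BddMeas (F (H.T₁ + n)) fun ω => memErr P O H (D ω) n k :=
  (bddMeas_comp_secondPhase hrun hP hs hO hT hn (hP.continuousOn_gpos k)).sub
    (bddMeas_mu hrun hP hs hO hT hn k)

lemma bddMeas_p [Nonempty (Fin m)] (k : Fin m) :
    BddMeas (F (H.T₁ + n)) fun ω => (secondPhase P O H (D ω) n).val.p k := by
  refine ⟨(measurable_secondPhase hrun hP hs hO hT hn).2.1 k, 1, fun ω => ?_⟩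
  rw [abs_of_pos (secondPhase_p_pos n k)]
  exact secondPhase_p_le_one n k

lemma bddMeas_secondPhase :
    BddMeas mΩ fun ω => ‖(secondPhase P O H (D ω) n).val.w - wstar‖ ^ 2 :=
  (bddMeas_comp_secondPhase hrun hP hs hO hT hn
    (φ := fun w => ‖w - wstar‖ ^ 2) (by fun_prop)).mono (F.le _)

lemma bddMeas_lagrangian {q : Ω → Fin m → ℝ} (hq : ∀ k, BddMeas (F (H.T₁ + n)) fun ω => q ω k) :
    BddMeas mΩ fun ω => P.lagrangian H.γ (secondPhase P O H (D ω) n).val.w (q ω) := by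
  unfold Problem.lagrangian
  exact ((bddMeas_comp_secondPhase hrun hP hs hO hT hn hP.continuousOn_f).add
    ((BddMeas.const _).mul (BddMeas.sum _ fun k => (hq k).mul
      (bddMeas_comp_secondPhase hrun hP hs hO hT hn (hP.continuousOn_gpos k))))).mono (F.le _)

end Bounded

section Step

variable {n : ℕ} (hn : n < H.T₂)
include hn

omit [IsProbabilityMeasure μ] hP hs hO hT in
lemma measurable_j : Measurable fun ω => (D ω).j (H.T₁ + n + 1) :=
  (hrun.j_meas _ (by omega) (by omega)).mono (F.le _) le_rfl

include hγ in
lemma integral_secondDir_ge [Nonempty (Fin m)] :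
    Integrable (fun ω => inner ℝ (secondDir P O H (D ω) n)
        ((secondPhase P O H (D ω) n).val.w - wstar)) μ ∧
      ∫ ω, P.lagrangian H.γ (secondPhase P O H (D ω) n).val.w
          (secondPhase P O H (D ω) n).val.p ∂μ - P.f wstar
        + H.lam / 2 * ∫ ω, ‖(secondPhase P O H (D ω) n).val.w - wstar‖ ^ 2 ∂μ
        ≤ ∫ ω, inner ℝ (secondDir P O H (D ω) n)
          ((secondPhase P O H (D ω) n).val.w - wstar) ∂μ := by
  set w : Ω → Vec d := fun ω => (secondPhase P O H (D ω) n).val.w with hwdef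
  have hw : Measurable[F (H.T₁ + n)] w := (measurable_secondPhase hrun hP hs hO hT hn.le).1
  have hwW : ∀ ω, w ω ∈ P.W := fun ω => secondPhase_w_mem hP hs (hrun.init_mem ω) hT n
  obtain ⟨h1, h2⟩ := integral_inner_subgradient_ge (μ := μ) hP hs (F.le (H.T₁ + n)) hw hwW
    (integrable_sg hrun (t := H.T₁ + n + 1) (by omega) (by omega)) (hrun.sg_second n hn)
  have hi : Measurable fun ω => (D ω).i (H.T₁ + n + 1) :=
    (hrun.i_meas _ (by omega) (by omega)).mono (F.le _) le_rfl
  have hg : ∀ k, BddMeas (F (H.T₁ + n)) fun ω => inner ℝ (O.grad k (w ω)) (w ω - wstar) :=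
    fun k => bddMeas_inner_grad hP hO (measurable_const (a := k)) hw hwW
  have h3 := (bddMeas_inner_grad (wstar := wstar) hP hO hi (hw.mono (F.le _) le_rfl)
    hwW).integrable (μ := μ)
  have h4 := integral_condExp_index (μ := μ) (F.le (H.T₁ + n)) hi
    (c := fun k ω => inner ℝ (O.grad k (w ω)) (w ω - wstar)) hg (hrun.i_law n hn)
  have e : (fun ω => inner ℝ (secondDir P O H (D ω) n) (w ω - wstar)) = fun ω =>
      inner ℝ ((D ω).sg (H.T₁ + n + 1)) (w ω - wstar)
        + H.γ * inner ℝ (O.grad ((D ω).i (H.T₁ + n + 1)) (w ω)) (w ω - wstar) := by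
    ext ω
    simp only [secondDir, inner_add_left, real_inner_smul_left, hwdef]
  have hp := bddMeas_p hrun hP hs hO hT hn.le
  have hL : Integrable
      (fun ω => P.lagrangian H.γ (w ω) (secondPhase P O H (D ω) n).val.p) μ :=
    (bddMeas_lagrangian hrun hP hs hO hT hn.le hp).integrable
  have hL' : Integrable
      (fun ω => P.lagrangian H.γ (w ω) (secondPhase P O H (D ω) n).val.p - P.f wstar) μ :=
    hL.sub (integrable_const _)
  have hD : Integrable (fun ω => ‖w ω - wstar‖ ^ 2) μ :=
    (bddMeas_secondPhase hrun hP hs hO hT hn.le).integrable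
  have hsum := ((BddMeas.sum Finset.univ fun k => (hp k).mul (hg k)).mono (F.le _)).integrable
    (μ := μ)
  have hfB := ((((bddMeas_comp hP hP.continuousOn_f hw hwW).sub (.const (P.f wstar))).add
      ((BddMeas.const (H.lam / 2)).mul (bddMeas_norm_sub_sq (wstar := wstar) hP hw hwW))).mono
        (F.le _)).integrable (μ := μ)
  change Integrable (fun ω => inner ℝ (secondDir P O H (D ω) n) (w ω - wstar)) μ ∧
    _ ≤ ∫ ω, inner ℝ (secondDir P O H (D ω) n) (w ω - wstar) ∂μ
  rw [e]
  refine ⟨h1.add (h3.const_mul _), ?_⟩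
  rw [integral_add h1 (h3.const_mul _), integral_const_mul, h4]
  refine le_trans ?_ (add_le_add_left h2 _)
  have e2 : ∫ ω, P.lagrangian H.γ (w ω) (secondPhase P O H (D ω) n).val.p ∂μ - P.f wstar
        + H.lam / 2 * ∫ ω, ‖w ω - wstar‖ ^ 2 ∂μ
      = ∫ ω, (P.lagrangian H.γ (w ω) (secondPhase P O H (D ω) n).val.p - P.f wstar
        + H.lam / 2 * ‖w ω - wstar‖ ^ 2) ∂μ := by
    rw [integral_add hL' (hD.const_mul _),
      integral_sub hL (integrable_const _), integral_const_mul]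
    simp
  refine e2.le.trans ?_
  rw [← integral_const_mul, ← integral_add hfB (hsum.const_mul _)]
  refine integral_mono (hL'.add (hD.const_mul _))
    (hfB.add (hsum.const_mul _)) fun ω => ?_
  have h5 : ∑ k, (secondPhase P O H (D ω) n).val.p k * P.gpos k (w ω)
      ≤ ∑ k, (secondPhase P O H (D ω) n).val.p k * inner ℝ (O.grad k (w ω)) (w ω - wstar) :=
    Finset.sum_le_sum fun k _ => mul_le_mul_of_nonneg_left
      (gpos_le_inner_grad hs hO k (hwW ω)) (secondPhase_p_pos n k).le
  have h6 := mul_le_mul_of_nonneg_left h5 hγ.le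
  change P.lagrangian H.γ (w ω) (secondPhase P O H (D ω) n).val.p - P.f wstar
      + H.lam / 2 * ‖w ω - wstar‖ ^ 2
    ≤ P.f (w ω) - P.f wstar + H.lam / 2 * ‖w ω - wstar‖ ^ 2
      + H.γ * ∑ k, (secondPhase P O H (D ω) n).val.p k
        * inner ℝ (O.grad k (w ω)) (w ω - wstar)
  unfold Problem.lagrangian
  linarith

/-- Unbiasedness: averaged over uniform `j`, the correction `γ m e_j (x j - mu j)` replaces the
stale values by the current ones, and the Lagrangian is affine in its weights. -/
lemma integral_pGradient [Nonempty (Fin m)] (q : Fin m → ℝ) :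
    Integrable (fun ω => ∑ k, (q k - (secondPhase P O H (D ω) n).val.p k)
        * pGradient H (secondPhase P O H (D ω) n).val.mu ((D ω).j (H.T₁ + n + 1))
          (P.gpos ((D ω).j (H.T₁ + n + 1)) (secondPhase P O H (D ω) n).val.w) k) μ ∧
      ∫ ω, ∑ k, (q k - (secondPhase P O H (D ω) n).val.p k)
        * pGradient H (secondPhase P O H (D ω) n).val.mu ((D ω).j (H.T₁ + n + 1))
          (P.gpos ((D ω).j (H.T₁ + n + 1)) (secondPhase P O H (D ω) n).val.w) k ∂μ
        = ∫ ω, P.lagrangian H.γ (secondPhase P O H (D ω) n).val.w q ∂μ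
          - ∫ ω, P.lagrangian H.γ (secondPhase P O H (D ω) n).val.w
            (secondPhase P O H (D ω) n).val.p ∂μ := by
  have hp := bddMeas_p hrun hP hs hO hT hn.le
  have hmu := bddMeas_mu hrun hP hs hO hT hn.le
  have hx := fun k => bddMeas_comp_secondPhase hrun hP hs hO hT hn.le (hP.continuousOn_gpos k)
  have e := fun ω l => pGradient_apply (H := H) (secondPhase P O H (D ω) n).val.mu
    (fun l => P.gpos l (secondPhase P O H (D ω) n).val.w) l
  have hc : ∀ l, BddMeas (F (H.T₁ + n)) fun ω => ∑ k, (q k - (secondPhase P O H (D ω) n).val.p k)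
      * pGradient H (secondPhase P O H (D ω) n).val.mu l
        (P.gpos l (secondPhase P O H (D ω) n).val.w) k := by
    intro l
    refine BddMeas.sum _ fun k => ((BddMeas.const _).sub (hp k)).mul ?_
    simp only [e]
    refine ((BddMeas.const _).mul (hmu k)).add ?_
    split_ifs
    · exact (BddMeas.const _).mul ((hx k).sub (hmu k))
    · exact BddMeas.const 0
  have hj := measurable_j hrun hn
  refine ⟨(BddMeas.eval hj fun l => (hc l).mono (F.le _)).integrable, ?_⟩
  have h := integral_condExp_index (μ := μ) (F.le (H.T₁ + n)) hj hc
    (q := fun _ _ => 1 / (m : ℝ)) (hrun.j_law n hn)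
  refine h.trans ?_
  rw [← integral_sub (bddMeas_lagrangian hrun hP hs hO hT hn.le fun k =>
    BddMeas.const (q k)).integrable (bddMeas_lagrangian hrun hP hs hO hT hn.le hp).integrable]
  congr 1
  ext ω
  have hm : 0 < m := Fin.pos_iff_nonempty.2 ‹_›
  have hm' : (m : ℝ) ≠ 0 := by positivity
  rw [← Finset.mul_sum, Finset.sum_comm]
  have h2 : ∀ k, ∑ l, pGradient H (secondPhase P O H (D ω) n).val.mu l
        (P.gpos l (secondPhase P O H (D ω) n).val.w) k
      = m * (H.γ * P.gpos k (secondPhase P O H (D ω) n).val.w) := by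
    intro k
    simp only [e, Finset.sum_add_distrib, Finset.sum_ite_eq', Finset.mem_univ, if_true,
      Finset.sum_const, Finset.card_univ, Fintype.card_fin, nsmul_eq_mul]
    ring
  simp only [← Finset.mul_sum, h2, Problem.lagrangian]
  rw [add_sub_add_left_eq_sub, ← mul_sub, ← Finset.sum_sub_distrib, Finset.mul_sum, Finset.mul_sum]
  refine Finset.sum_congr rfl fun k _ => ?_
  field_simp

lemma integral_memErr_j :
    Integrable (fun ω => memErr P O H (D ω) n ((D ω).j (H.T₁ + n + 1)) ^ 2) μ ∧
      ∫ ω, memErr P O H (D ω) n ((D ω).j (H.T₁ + n + 1)) ^ 2 ∂μ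
        = 1 / (m : ℝ) * ∑ k, ∫ ω, memErr P O H (D ω) n k ^ 2 ∂μ := by
  have he := fun k => (bddMeas_memErr hrun hP hs hO hT hn.le k).pow_two
  have hj := measurable_j hrun hn
  refine ⟨(BddMeas.eval hj fun l => (he l).mono (F.le _)).integrable, ?_⟩
  refine (integral_condExp_index (μ := μ) (F.le (H.T₁ + n)) hj he
    (q := fun _ _ => 1 / (m : ℝ)) (hrun.j_law n hn)).trans ?_
  rw [integral_finsetSum _ fun k _ => (((he k).mono (F.le _)).integrable).const_mul _,
    Finset.mul_sum]
  simp only [integral_const_mul]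

include hγ hlam hLg in
lemma integral_memErr_succ_le (hm : 0 < m) (k : Fin m) :
    ∫ ω, memErr P O H (D ω) (n + 1) k ^ 2 ∂μ
      ≤ (1 - 1 / (2 * m)) * ∫ ω, memErr P O H (D ω) n k ^ 2 ∂μ
        + (1 + 2 * m) * (Lg * ((Gf + H.γ * Gg) / (H.lam * H.T₁))) ^ 2 := by
  have he := (bddMeas_memErr hrun hP hs hO hT hn.le k).pow_two
  have he' := ((bddMeas_memErr hrun hP hs hO hT hn k).pow_two.mono (F.le _)).integrable (μ := μ)
  have hj := measurable_j hrun hn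
  have hc : ∀ l, BddMeas (F (H.T₁ + n))
      fun ω => if l = k then 0 else memErr P O H (D ω) n k ^ 2 := by
    intro l
    split_ifs
    · exact BddMeas.const 0
    · exact he
  have h1 := (BddMeas.eval hj fun l => (hc l).mono (F.le _)).integrable (μ := μ)
  have h2 : ∫ ω, (if (D ω).j (H.T₁ + n + 1) = k then 0 else memErr P O H (D ω) n k ^ 2) ∂μ
      = (1 - 1 / m) * ∫ ω, memErr P O H (D ω) n k ^ 2 ∂μ := by
    refine (integral_condExp_index (μ := μ) (F.le (H.T₁ + n)) hj hc
      (q := fun _ _ => 1 / (m : ℝ)) (hrun.j_law n hn)).trans ?_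
    rw [← integral_const_mul]
    congr 1
    ext ω
    have e : ∀ l, (if l = k then 0 else memErr P O H (D ω) n k ^ 2)
        = memErr P O H (D ω) n k ^ 2 - if l = k then memErr P O H (D ω) n k ^ 2 else 0 := by
      intro l
      split_ifs <;> simp
    simp only [e, ← Finset.mul_sum, Finset.sum_sub_distrib, Finset.sum_ite_eq', Finset.mem_univ,
      if_true, Finset.sum_const, Finset.card_univ, Fintype.card_fin, nsmul_eq_mul]
    field_simp
  set c := (1 + 2 * (m : ℝ)) * (Lg * ((Gf + H.γ * Gg) / (H.lam * H.T₁))) ^ 2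
  have h3 : ∫ ω, memErr P O H (D ω) (n + 1) k ^ 2 ∂μ
      ≤ ∫ ω, ((1 + 1 / (2 * m)) * (if (D ω).j (H.T₁ + n + 1) = k then 0
        else memErr P O H (D ω) n k ^ 2) + c) ∂μ := by
    refine integral_mono_ae he' ((h1.const_mul _).add (integrable_const c)) ?_
    filter_upwards [ae_norm_sg_le hrun] with ω hω
    exact memErr_succ_sq_le hP hs hO (hrun.init_mem ω) hT hγ hlam hω hm hLg hn k
  rw [integral_add (h1.const_mul _) (integrable_const c), integral_const_mul, h2] at h3
  have h4 : ∫ _ : Ω, c ∂μ = c := by simp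
  rw [h4] at h3
  refine h3.trans (add_le_add ?_ le_rfl)
  rw [← mul_assoc]
  refine mul_le_mul_of_nonneg_right ?_ (integral_nonneg fun ω => sq_nonneg _)
  have hm' : (0 : ℝ) < m := by positivity
  -- Growth by Young's inequality times the probability of no refresh.
  have e : (1 + 1 / (2 * (m : ℝ))) * (1 - 1 / m) = 1 - 1 / (2 * m) - 1 / (2 * m ^ 2) := by
    field_simp
    ring
  rw [e]
  have : 0 ≤ 1 / (2 * (m : ℝ) ^ 2) := by positivity
  linarith

end Step

include hγ hlam hLg in
lemma integral_memErr_le (hm : 0 < m) {n : ℕ} (hn : n ≤ H.T₂) (k : Fin m) :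
    ∫ ω, memErr P O H (D ω) n k ^ 2 ∂μ
      ≤ 6 * m ^ 2 * (Lg * ((Gf + H.γ * Gg) / (H.lam * H.T₁))) ^ 2 := by
  induction n with
  | zero =>
    -- The memory starts exact, since all constraints are evaluated at the averaged starting point.
    have : ∀ ω, memErr P O H (D ω) 0 k = 0 := fun ω => by
      simp [memErr, secondPhase_zero_mu, secondPhase_zero_w]
    simp only [this]
    simp
    positivity
  | succ n ih =>
    refine (integral_memErr_succ_le hrun hP hs hO hT hγ hlam hLg (by omega) hm k).trans ?_
    have h1 := ih (by omega)
    set r := (Lg * ((Gf + H.γ * Gg) / (H.lam * H.T₁))) ^ 2 with hr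
    have hr0 : 0 ≤ r := sq_nonneg _
    have hm' : (1 : ℝ) ≤ m := by exact_mod_cast hm
    have h2 : 0 ≤ 1 - 1 / (2 * (m : ℝ)) := by
      rw [sub_nonneg, div_le_one (by positivity)]; linarith
    have h3 := mul_le_mul_of_nonneg_left h1 h2
    -- The constant `6` is chosen so that the contraction gains `3 m r`, enough to pay for the drift
    -- `(1 + 2m) r`.
    have e : (1 - 1 / (2 * (m : ℝ))) * (6 * m ^ 2 * r) = 6 * m ^ 2 * r - 3 * m * r := by
      field_simp
      ring
    rw [e] at h3
    nlinarith [mul_le_mul_of_nonneg_right hm' hr0]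

/-- The guarantee of the second phase. -/
lemma sum_integral_secondPhase_le [Nonempty (Fin m)] (hγ : 0 < H.γ) (hlam : 0 < H.lam)
    (hLg : 0 < Lg) (hη : H.η = H.lam / (2 * H.γ ^ 2 * Lg ^ 2)) {q : Fin m → ℝ}
    (hq : q ∈ stdSimplex ℝ (Fin m))
    (hmult : ∀ w ∈ P.W, P.f wstar + H.lam / 2 * ‖w - wstar‖ ^ 2 ≤ P.lagrangian H.γ w q) :
    3 / 8 * H.lam * ∑ n ∈ Finset.range H.T₂,
        ∫ ω, ‖(secondPhase P O H (D ω) n).val.w - wstar‖ ^ 2 ∂μ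
      ≤ H.lam / 2 * H.T₁ * ∫ ω, ‖firstAverage P O H (D ω) - wstar‖ ^ 2 ∂μ
        + (Gf + H.γ * Gg) ^ 2 / (2 * H.lam)
          * ∑ n ∈ Finset.range H.T₂, 1 / ((H.T₁ + n + 1 : ℕ) : ℝ)
        + 2 * H.γ ^ 2 * Lg ^ 2 * Real.log m / H.lam
        + H.T₂ * (12 * m ^ 4 * (Gf + H.γ * Gg) ^ 2 / (H.lam * H.T₁ ^ 2)) := by
  have hm : 0 < m := Fin.pos_iff_nonempty.2 ‹_›
  have hm1 : (1 : ℝ) ≤ m := by exact_mod_cast hm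
  have hT' : (0 : ℝ) < H.T₁ := by positivity
  set A : ℕ → Ω → ℝ := fun n ω => inner ℝ (secondDir P O H (D ω) n)
    ((secondPhase P O H (D ω) n).val.w - wstar) with hAdef
  set B : ℕ → Ω → ℝ := fun n ω => ∑ k, (q k - (secondPhase P O H (D ω) n).val.p k)
        * pGradient H (secondPhase P O H (D ω) n).val.mu ((D ω).j (H.T₁ + n + 1))
          (P.gpos ((D ω).j (H.T₁ + n + 1)) (secondPhase P O H (D ω) n).val.w) k with hBdef
  set X : ℕ → Ω → ℝ := fun n ω => ‖(secondPhase P O H (D ω) n).val.w - wstar‖ ^ 2 with hXdef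
  set E : ℕ → Ω → ℝ := fun n ω => ∑ k, memErr P O H (D ω) n k ^ 2
            + m ^ 2 * memErr P O H (D ω) n ((D ω).j (H.T₁ + n + 1)) ^ 2 with hEdef
  set Y : Ω → ℝ := fun ω => ‖firstAverage P O H (D ω) - wstar‖ ^ 2 with hYdef
  set c₁ := (Gf + H.γ * Gg) ^ 2 / (2 * H.lam)
          * ∑ n ∈ Finset.range H.T₂, 1 / ((H.T₁ + n + 1 : ℕ) : ℝ)
  set c₂ := 2 * H.γ ^ 2 * Lg ^ 2 * Real.log m / H.lam
  have hX : ∀ n ∈ Finset.range H.T₂, Integrable (X n) μ := fun n hn =>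
    (bddMeas_secondPhase hrun hP hs hO hT (Finset.mem_range.1 hn).le).integrable
  have hA := fun n (hn : n ∈ Finset.range H.T₂) => integral_secondDir_ge (wstar := wstar) (μ := μ)
    hrun hP hs hO hT hγ (Finset.mem_range.1 hn)
  have hB := fun n (hn : n ∈ Finset.range H.T₂) => integral_pGradient (μ := μ)
    hrun hP hs hO hT (Finset.mem_range.1 hn) q
  have hEk := fun n (hn : n ∈ Finset.range H.T₂) k => ((bddMeas_memErr hrun hP hs hO hT
    (Finset.mem_range.1 hn).le k).pow_two.mono (F.le _)).integrable (μ := μ)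
  have hEj := fun n (hn : n ∈ Finset.range H.T₂) => integral_memErr_j (μ := μ)
    hrun hP hs hO hT (Finset.mem_range.1 hn)
  have hE : ∀ n ∈ Finset.range H.T₂, Integrable (E n) μ := fun n hn =>
    (integrable_finsetSum _ fun k _ => hEk n hn k).add ((hEj n hn).1.const_mul _)
  have hY : Integrable Y μ := ((bddMeas_norm_sub_sq hP (measurable_firstAverage hrun hP hs hO)
      fun ω => firstAverage_mem hP hs (hrun.init_mem ω) hT).mono (F.le _)).integrable
  have hpath : ∀ᵐ ω ∂μ, ∑ n ∈ Finset.range H.T₂, (A n ω - H.lam / 2 * X n ω + B n ω)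
      ≤ H.lam / 2 * H.T₁ * Y ω + (c₁ + c₂)
        + ∑ n ∈ Finset.range H.T₂, (H.lam / 8 * X n ω + H.lam / Lg ^ 2 * E n ω) := by
    filter_upwards [ae_norm_sg_le hrun] with ω hω
    have h1 := sum_secondDir_le (wstar := wstar) hP hs hO (hrun.init_mem ω) hT hγ hlam hω
    have h2 := sum_pGradient_le (wstar := wstar) (O := O) hP hs (hrun.init_mem ω) hT hγ hlam hLg
      hη hq H.T₂
    rw [Finset.sum_add_distrib]
    exact (add_le_add h1 h2).trans (le_of_eq (by ring))
  have hI₁ : ∀ n ∈ Finset.range H.T₂,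
      Integrable (fun ω => A n ω - H.lam / 2 * X n ω + B n ω) μ := fun n hn =>
    ((hA n hn).1.sub ((hX n hn).const_mul _)).add (hB n hn).1
  have hI₂ : ∀ n ∈ Finset.range H.T₂,
      Integrable (fun ω => H.lam / 8 * X n ω + H.lam / Lg ^ 2 * E n ω) μ := fun n hn =>
    ((hX n hn).const_mul _).add ((hE n hn).const_mul _)
  have hI₃ : Integrable (fun ω => H.lam / 2 * H.T₁ * Y ω + (c₁ + c₂)) μ :=
    (hY.const_mul _).add (integrable_const _)
  have hmain := integral_mono_ae (μ := μ) (integrable_finsetSum _ hI₁)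
    (hI₃.add (integrable_finsetSum _ hI₂)) hpath
  rw [integral_finsetSum _ hI₁] at hmain
  simp only [Pi.add_apply] at hmain
  rw [integral_add hI₃ (integrable_finsetSum _ hI₂), integral_finsetSum _ hI₂,
    integral_add (hY.const_mul _) (integrable_const _), integral_const_mul] at hmain
  -- The Lagrangian at the random `p` cancels between the two players; what remains is the
  -- Lagrangian at `q`, whose growth supplies the quadratic term.
  have hlow : ∀ n ∈ Finset.range H.T₂, H.lam / 2 * ∫ ω, X n ω ∂μ
      ≤ ∫ ω, (A n ω - H.lam / 2 * X n ω + B n ω) ∂μ := by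
    intro n hn
    have hAi : Integrable (A n) μ := (hA n hn).1
    have hBi : Integrable (B n) μ := (hB n hn).1
    have hAX : Integrable (fun ω => A n ω - H.lam / 2 * X n ω) μ :=
      hAi.sub ((hX n hn).const_mul _)
    have hBe : ∫ ω, B n ω ∂μ = _ := (hB n hn).2
    rw [integral_add hAX hBi, integral_sub hAi ((hX n hn).const_mul _), integral_const_mul, hBe]
    have hL := (bddMeas_lagrangian hrun hP hs hO hT (Finset.mem_range.1 hn).le fun k =>
      BddMeas.const (q k)).integrable (μ := μ)
    have h2 : P.f wstar + H.lam / 2 * ∫ ω, X n ω ∂μ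
        ≤ ∫ ω, P.lagrangian H.γ (secondPhase P O H (D ω) n).val.w q ∂μ := by
      have hXc : Integrable (fun ω => P.f wstar + H.lam / 2 * X n ω) μ :=
        (integrable_const _).add ((hX n hn).const_mul _)
      have h3 := integral_mono hXc hL
        fun ω => hmult _ (secondPhase_w_mem hP hs (hrun.init_mem ω) hT n)
      rw [integral_add (integrable_const _) ((hX n hn).const_mul _), integral_const_mul] at h3
      simpa using h3
    have h1 := (hA n hn).2
    linarith
  have hup : ∀ n ∈ Finset.range H.T₂, ∫ ω, (H.lam / 8 * X n ω + H.lam / Lg ^ 2 * E n ω) ∂μ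
      ≤ H.lam / 8 * ∫ ω, X n ω ∂μ + 12 * m ^ 4 * (Gf + H.γ * Gg) ^ 2 / (H.lam * H.T₁ ^ 2) := by
    intro n hn
    rw [integral_add ((hX n hn).const_mul _) ((hE n hn).const_mul _), integral_const_mul,
      integral_const_mul, integral_add (integrable_finsetSum _ fun k _ => hEk n hn k)
        ((hEj n hn).1.const_mul _), integral_finsetSum _ fun k _ => hEk n hn k, integral_const_mul,
      (hEj n hn).2]
    have h1 : ∑ k, ∫ ω, memErr P O H (D ω) n k ^ 2 ∂μ
        ≤ m * (6 * m ^ 2 * (Lg * ((Gf + H.γ * Gg) / (H.lam * H.T₁))) ^ 2) := by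
      refine (Finset.sum_le_sum fun k _ => integral_memErr_le hrun hP hs hO hT hγ hlam hLg hm
        (Finset.mem_range.1 hn).le k).trans (le_of_eq ?_)
      simp
    set S := ∑ k, ∫ ω, memErr P O H (D ω) n k ^ 2 ∂μ
    have hS : 0 ≤ S := Finset.sum_nonneg fun k _ => integral_nonneg fun ω => sq_nonneg _
    -- Averaging over `j` reduces the variance factor `m²` to `m`; with `m` entries of mean square
    -- at most `6 m² r²`, where `r = Lg G / (lam T₁)` and `G = Gf + γ Gg`, this produces `12 m⁴`.
    have e : S + (m : ℝ) ^ 2 * (1 / m * S) = S + m * S := by field_simp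
    rw [e]
    refine add_le_add le_rfl ?_
    have h2 : S + m * S ≤ 2 * m * S := by nlinarith
    have h3 := mul_le_mul_of_nonneg_left h1 (by positivity : (0 : ℝ) ≤ 2 * m)
    refine (mul_le_mul_of_nonneg_left (h2.trans h3) (by positivity)).trans (le_of_eq ?_)
    field_simp
    ring
  have h1 := Finset.sum_le_sum hlow
  have h2 := Finset.sum_le_sum hup
  rw [← Finset.mul_sum] at h1
  rw [Finset.sum_add_distrib, ← Finset.mul_sum, Finset.sum_const, Finset.card_range,
    nsmul_eq_mul] at h2
  have h3 : ∫ _ : Ω, (c₁ + c₂) ∂μ = c₁ + c₂ := by simp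
  rw [h3] at hmain
  linarith

end SecondPhase

/-! ### Choice of the phase lengths and comparison with the rates. -/

section Rates

variable {m : ℕ} {γ lam Lg Gf Gg ε : ℝ}

lemma sum_one_div_le (T N : ℕ) :
    ∑ n ∈ Finset.range T, 1 / ((n + 1 : ℕ) : ℝ)
      + ∑ n ∈ Finset.range N, 1 / ((T + n + 1 : ℕ) : ℝ) ≤ 1 + Real.log (T + N) := by
  have h := harmonic_le_one_add_log (T + N)
  rw [harmonic] at h
  rw [← Finset.sum_range_add (fun n => 1 / ((n + 1 : ℕ) : ℝ))]
  refine le_trans (le_of_eq ?_) (h.trans (le_of_eq (by push_cast; rfl)))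
  push_cast
  simp only [one_div]

/-- The length of the first phase. -/
noncomputable def phaseLength₁ (m : ℕ) (γ lam Gf Gg ε : ℝ) : ℕ :=
  ⌈8 * ((m : ℝ) ^ 2 * (Gf + γ * Gg) / (lam * √ε))⌉₊ + 1

/-- The length of the second phase. -/
noncomputable def phaseLength₂ (m : ℕ) (γ lam Lg Gf Gg ε : ℝ) : ℕ :=
  ⌈64 * ((1 + Real.log m) * logTerm γ lam Lg Gf Gg ε
    * ((Gf + γ * Gg + γ * Lg) ^ 2 / (lam ^ 2 * ε)))⌉₊ + 1

section Positivity

variable (hm : 0 < m) (hγ : 0 < γ) (hlam : 0 < lam) (hLg : 0 < Lg) (hGf : 0 ≤ Gf) (hGg : 0 ≤ Gg)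
  (hε : 0 < ε)

include hm in
lemma one_le_one_add_log : 1 ≤ 1 + Real.log m := by
  have : (1 : ℝ) ≤ m := by exact_mod_cast hm
  linarith [Real.log_nonneg this]

include hlam hε

lemma one_le_logTerm : 1 ≤ logTerm γ lam Lg Gf Gg ε := by
  have : 0 ≤ (Gf + γ * Gg + γ * Lg) ^ 2 / (lam ^ 2 * ε) := by positivity
  unfold logTerm
  linarith [Real.log_nonneg (by linarith : 1 ≤ 1 + (Gf + γ * Gg + γ * Lg) ^ 2 / (lam ^ 2 * ε))]

include hγ hGf hGg

omit hγ hlam hGf hGg hε in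
lemma ceil_le {x : ℝ} (hx : 0 ≤ x) : ((⌈x⌉₊ + 1 : ℕ) : ℝ) ≤ x + 2 := by
  push_cast
  linarith [Nat.ceil_lt_add_one hx]

lemma phaseLength₁_le :
    (phaseLength₁ m γ lam Gf Gg ε : ℝ) ≤ 8 * ((m : ℝ) ^ 2 * (Gf + γ * Gg) / (lam * √ε)) + 2 :=
  ceil_le (by positivity)

include hm hLg

lemma phaseLength₂_le : (phaseLength₂ m γ lam Lg Gf Gg ε : ℝ)
    ≤ 64 * ((1 + Real.log m) * logTerm γ lam Lg Gf Gg ε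
      * ((Gf + γ * Gg + γ * Lg) ^ 2 / (lam ^ 2 * ε))) + 2 := by
  have h1 := one_le_one_add_log hm
  have h2 := one_le_logTerm (γ := γ) (Lg := Lg) (Gf := Gf) (Gg := Gg) hlam hε
  refine ceil_le ?_
  have : 0 ≤ (Gf + γ * Gg + γ * Lg) ^ 2 / (lam ^ 2 * ε) := by positivity
  have h3 : 0 ≤ 1 + Real.log m := by linarith
  have h4 : 0 ≤ logTerm γ lam Lg Gf Gg ε := by linarith
  positivity

/-- The logarithms produced by the harmonic sums are controlled by the logarithmic factors. -/
lemma log_phaseLength_le :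
    (1 + Real.log (phaseLength₁ m γ lam Gf Gg ε + phaseLength₂ m γ lam Lg Gf Gg ε)) / 2
      + 2 * Real.log m ≤ 12 * ((1 + Real.log m) * logTerm γ lam Lg Gf Gg ε) := by
  have hT₁ := phaseLength₁_le (m := m) hγ hlam hGf hGg hε
  have hT₂ := phaseLength₂_le hm hγ hlam hLg hGf hGg hε
  have hpos : (0 : ℝ) < phaseLength₁ m γ lam Gf Gg ε := by
    unfold phaseLength₁; positivity
  have hℓ := one_le_one_add_log hm
  have hΛ := one_le_logTerm (γ := γ) (Lg := Lg) (Gf := Gf) (Gg := Gg) hlam hε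
  have hm1 : (1 : ℝ) ≤ m := by exact_mod_cast hm
  set X := (Gf + γ * Gg + γ * Lg) ^ 2 / (lam ^ 2 * ε) with hX
  have hX0 : 0 ≤ X := by positivity
  set U := 1 + X with hU
  have hU1 : 1 ≤ U := by linarith
  have hℓm : 1 + Real.log m ≤ m := by
    linarith [Real.log_le_sub_one_of_pos (by linarith : (0 : ℝ) < m)]
  have hΛU : logTerm γ lam Lg Gf Gg ε ≤ U := by
    have := Real.log_le_sub_one_of_pos (by linarith : 0 < U)
    unfold logTerm
    linarith
  have hR : (Gf + γ * Gg) / (lam * √ε) ≤ U := by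
    have h1 : (Gf + γ * Gg) / (lam * √ε) ≤ (Gf + γ * Gg + γ * Lg) / (lam * √ε) := by
      exact div_le_div_of_nonneg_right (by linarith [mul_pos hγ hLg]) (by positivity)
    have h2 : ((Gf + γ * Gg + γ * Lg) / (lam * √ε)) ^ 2 = X := by
      rw [hX, div_pow, mul_pow, Real.sq_sqrt hε.le]
    nlinarith [sq_nonneg ((Gf + γ * Gg + γ * Lg) / (lam * √ε) - 1)]
  have hmU : 1 ≤ (m : ℝ) ^ 2 * U ^ 2 := one_le_mul_of_one_le_of_one_le (one_le_pow₀ hm1)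
    (one_le_pow₀ hU1)
  have h1 : 8 * ((m : ℝ) ^ 2 * (Gf + γ * Gg) / (lam * √ε)) ≤ 8 * ((m : ℝ) ^ 2 * U ^ 2) := by
    rw [mul_div_assoc]
    have : U ≤ U ^ 2 := by nlinarith
    gcongr
    linarith
  have h2 : 64 * ((1 + Real.log m) * logTerm γ lam Lg Gf Gg ε * X)
      ≤ 64 * ((m : ℝ) ^ 2 * U ^ 2) := by
    have h3 : (1 + Real.log m) * logTerm γ lam Lg Gf Gg ε * X ≤ m * U * U := by
      gcongr
      linarith
    have h4 : (m : ℝ) * U * U ≤ (m : ℝ) ^ 2 * U ^ 2 := by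
      have : (m : ℝ) ≤ (m : ℝ) ^ 2 := by nlinarith
      nlinarith [mul_le_mul_of_nonneg_right this (sq_nonneg U)]
    linarith
  -- A crude polynomial bound suffices inside the logarithm, although the second length itself
  -- contains `logTerm`; here `76 = 8 + 64 + 2 + 2`.
  have h3 : (phaseLength₁ m γ lam Gf Gg ε : ℝ) + phaseLength₂ m γ lam Lg Gf Gg ε
      ≤ 76 * ((m : ℝ) ^ 2 * U ^ 2) := by linarith
  have h4 := Real.log_le_log (by positivity) h3
  rw [Real.log_mul (by norm_num) (by positivity), Real.log_mul (by positivity) (by positivity),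
    Real.log_pow, Real.log_pow] at h4
  have h5 : Real.log 76 ≤ 5 := by
    rw [Real.log_le_iff_le_exp (by norm_num)]
    have h6 : Real.exp 5 = Real.exp 1 ^ 5 := by rw [← Real.exp_nat_mul]; norm_num
    rw [h6]
    calc (76 : ℝ) ≤ 2.7 ^ 5 := by norm_num
      _ ≤ _ := pow_le_pow_left₀ (by norm_num) (by linarith [Real.exp_one_gt_d9]) 5
  have h6 : logTerm γ lam Lg Gf Gg ε = 1 + Real.log U := rfl
  push_cast at h4
  nlinarith [mul_nonneg (sub_nonneg.2 hℓ) (sub_nonneg.2 hΛ)]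

/-- The chosen lengths push the error bounds of the two phases below `ε`. -/
lemma error_le {s : ℝ}
    (hs : 3 / 8 * lam * s ≤ (Gf + γ * Gg) ^ 2 / (2 * lam)
        * (1 + Real.log (phaseLength₁ m γ lam Gf Gg ε + phaseLength₂ m γ lam Lg Gf Gg ε))
      + 2 * γ ^ 2 * Lg ^ 2 * Real.log m / lam
      + phaseLength₂ m γ lam Lg Gf Gg ε * (12 * m ^ 4 * (Gf + γ * Gg) ^ 2
        / (lam * (phaseLength₁ m γ lam Gf Gg ε : ℝ) ^ 2))) :
    1 / (phaseLength₂ m γ lam Lg Gf Gg ε : ℝ) * s ≤ ε := by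
  have hlog := log_phaseLength_le hm hγ hlam hLg hGf hGg hε
  have h1 : 8 * ((m : ℝ) ^ 2 * (Gf + γ * Gg) / (lam * √ε)) ≤ phaseLength₁ m γ lam Gf Gg ε := by
    unfold phaseLength₁
    push_cast
    linarith [Nat.le_ceil (8 * ((m : ℝ) ^ 2 * (Gf + γ * Gg) / (lam * √ε)))]
  have h2 : 64 * ((1 + Real.log m) * logTerm γ lam Lg Gf Gg ε
    * ((Gf + γ * Gg + γ * Lg) ^ 2 / (lam ^ 2 * ε))) ≤ phaseLength₂ m γ lam Lg Gf Gg ε := by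
    unfold phaseLength₂
    push_cast
    linarith [Nat.le_ceil (64 * ((1 + Real.log m) * logTerm γ lam Lg Gf Gg ε
      * ((Gf + γ * Gg + γ * Lg) ^ 2 / (lam ^ 2 * ε))))]
  have hpos₁ : (1 : ℝ) ≤ phaseLength₁ m γ lam Gf Gg ε := by
    unfold phaseLength₁; push_cast; linarith [Nat.cast_nonneg (α := ℝ)
      ⌈8 * ((m : ℝ) ^ 2 * (Gf + γ * Gg) / (lam * √ε))⌉₊]
  have hpos₂ : (0 : ℝ) < phaseLength₂ m γ lam Lg Gf Gg ε := by
    unfold phaseLength₂; positivity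
  have hlogm : 0 ≤ Real.log m := by linarith [one_le_one_add_log hm]
  set T₁ := (phaseLength₁ m γ lam Gf Gg ε : ℝ)
  set T₂ := (phaseLength₂ m γ lam Lg Gf Gg ε : ℝ)
  have hlogT : 0 ≤ Real.log (T₁ + T₂) := Real.log_nonneg (by linarith)
  set K := (1 + Real.log m) * logTerm γ lam Lg Gf Gg ε
  set S := Gf + γ * Gg + γ * Lg with hS
  have hGS : (Gf + γ * Gg) ^ 2 ≤ S ^ 2 :=
    pow_le_pow_left₀ (by positivity) (by linarith [mul_pos hγ hLg]) 2
  have hLS : γ ^ 2 * Lg ^ 2 ≤ S ^ 2 := by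
    rw [← mul_pow]
    exact pow_le_pow_left₀ (by positivity) (by nlinarith [mul_nonneg hγ.le hGg]) 2
  -- The budget `3 / 8 * lam * ε * T₂` is split evenly. This half fixes the constant of the second
  -- length, `64 = 12 * 16 / 3`.
  have hmain : (Gf + γ * Gg) ^ 2 / (2 * lam) * (1 + Real.log (T₁ + T₂))
      + 2 * γ ^ 2 * Lg ^ 2 * Real.log m / lam ≤ 3 / 16 * lam * ε * T₂ := by
    calc _ ≤ S ^ 2 / (2 * lam) * (1 + Real.log (T₁ + T₂)) + 2 * S ^ 2 * Real.log m / lam := by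
          rw [mul_assoc 2 (γ ^ 2)]
          gcongr
      _ = S ^ 2 / lam * ((1 + Real.log (T₁ + T₂)) / 2 + 2 * Real.log m) := by
          field_simp
      _ ≤ S ^ 2 / lam * (12 * K) := by gcongr
      _ = 3 / 16 * lam * ε * (64 * (K * (S ^ 2 / (lam ^ 2 * ε)))) := by
          field_simp
          ring
      _ ≤ _ := by gcongr
  -- The memory errors get the other half, which requires `T₁² ≥ 64 m⁴ (Gf + γ Gg)² / (lam² ε)`;
  -- hence the `8` in the first length.
  have hrest : 12 * (m : ℝ) ^ 4 * (Gf + γ * Gg) ^ 2 / (lam * T₁ ^ 2) ≤ 3 / 16 * lam * ε := by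
    have h3 := pow_le_pow_left₀ (by positivity) h1 2
    have e : (8 * ((m : ℝ) ^ 2 * (Gf + γ * Gg) / (lam * √ε))) ^ 2
        = 64 * (m : ℝ) ^ 4 * (Gf + γ * Gg) ^ 2 / (lam ^ 2 * ε) := by
      rw [mul_pow, div_pow, mul_pow lam, Real.sq_sqrt hε.le]
      ring
    rw [e, div_le_iff₀ (by positivity)] at h3
    rw [div_le_iff₀ (by positivity)]
    nlinarith
  have h3 := mul_le_mul_of_nonneg_left hrest hpos₂.le
  rw [one_div, inv_mul_le_iff₀ hpos₂]
  have h4 : 3 / 8 * lam * s ≤ 3 / 8 * lam * (T₂ * ε) := by linarith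
  exact le_of_mul_le_mul_left h4 (by positivity)

lemma phaseLength₁_le_rate : (phaseLength₁ m γ lam Gf Gg ε : ℝ)
    ≤ 128 * (1 + rate₁ m γ lam Lg Gf Gg ε) * logTerm γ lam Lg Gf Gg ε ^ 1 := by
  have hℓ := one_le_one_add_log hm
  have hΛ := one_le_logTerm (γ := γ) (Lg := Lg) (Gf := Gf) (Gg := Gg) hlam hε
  refine (phaseLength₁_le hγ hlam hGf hGg hε).trans ?_
  have h0 : 0 ≤ m * (1 + Real.log m) ^ (2 / 3 : ℝ) * (Gf + γ * Gg + γ * Lg) ^ (4 / 3 : ℝ)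
      / (lam ^ (4 / 3 : ℝ) * ε ^ (2 / 3 : ℝ)) := by
    have : 0 ≤ 1 + Real.log m := by linarith
    positivity
  have h1 : (m : ℝ) ^ 2 * (Gf + γ * Gg) / (lam * √ε)
      ≤ (m : ℝ) ^ 2 * (1 + Real.log m) * (Gf + γ * Gg) / (lam * √ε) := by
    gcongr
    exact le_mul_of_one_le_right (by positivity) hℓ
  have h2 : 0 ≤ (m : ℝ) ^ 2 * (Gf + γ * Gg) / (lam * √ε) := by positivity
  rw [pow_one]
  refine le_trans ?_ (le_mul_of_one_le_right ?_ hΛ) <;> unfold rate₁ <;> linarith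

lemma phaseLength₂_le_rate : (phaseLength₂ m γ lam Lg Gf Gg ε : ℝ)
    ≤ 128 * (1 + rate₂ m γ lam Lg Gf Gg ε) * logTerm γ lam Lg Gf Gg ε ^ 1 := by
  have hℓ := one_le_one_add_log hm
  have hΛ := one_le_logTerm (γ := γ) (Lg := Lg) (Gf := Gf) (Gg := Gg) hlam hε
  have hℓ0 : 0 ≤ 1 + Real.log m := by linarith
  refine (phaseLength₂_le hm hγ hlam hLg hGf hGg hε).trans ?_
  have h0 : 0 ≤ (m : ℝ) ^ (3 / 2 : ℝ) * (1 + Real.log m) ^ (3 / 2 : ℝ)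
      * (Gf + γ * Gg) ^ (3 / 2 : ℝ) / (lam ^ (3 / 2 : ℝ) * ε ^ (3 / 4 : ℝ)) := by
    positivity
  have h1 : 0 ≤ (1 + Real.log m) * (Gf + γ * Gg + γ * Lg) ^ 2 / (lam ^ 2 * ε) := by positivity
  have e : (1 + Real.log m) * logTerm γ lam Lg Gf Gg ε
      * ((Gf + γ * Gg + γ * Lg) ^ 2 / (lam ^ 2 * ε))
      = (1 + Real.log m) * (Gf + γ * Gg + γ * Lg) ^ 2 / (lam ^ 2 * ε)
        * logTerm γ lam Lg Gf Gg ε := by ring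
  rw [e, pow_one]
  unfold rate₂
  nlinarith [mul_nonneg h0 (zero_le_one.trans hΛ), mul_nonneg h1 (zero_le_one.trans hΛ)]

lemma checks_le_rate :
    ((phaseLength₁ m γ lam Gf Gg ε * (m + 1) + m + 2 * phaseLength₂ m γ lam Lg Gf Gg ε : ℕ) : ℝ)
      ≤ 128 * (m + checkRate m γ lam Lg Gf Gg ε) * logTerm γ lam Lg Gf Gg ε ^ 1 := by
  have hℓ := one_le_one_add_log hm
  have hΛ := one_le_logTerm (γ := γ) (Lg := Lg) (Gf := Gf) (Gg := Gg) hlam hε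
  have hℓ0 : 0 ≤ 1 + Real.log m := by linarith
  have hm1 : (1 : ℝ) ≤ m := by exact_mod_cast hm
  have hT₁ := phaseLength₁_le (m := m) hγ hlam hGf hGg hε
  have hT₂ := phaseLength₂_le hm hγ hlam hLg hGf hGg hε
  set A := (1 + Real.log m) * (Gf + γ * Gg + γ * Lg) ^ 2 / (lam ^ 2 * ε) with hA
  set B := (m : ℝ) ^ (3 / 2 : ℝ) * (1 + Real.log m) ^ (3 / 2 : ℝ) * (Gf + γ * Gg) ^ (3 / 2 : ℝ)
      / (lam ^ (3 / 2 : ℝ) * ε ^ (3 / 4 : ℝ)) with hB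
  set E := (m : ℝ) ^ 2 * (1 + Real.log m) ^ (2 / 3 : ℝ) * (Gf + γ * Gg + γ * Lg) ^ (4 / 3 : ℝ)
      / (lam ^ (4 / 3 : ℝ) * ε ^ (2 / 3 : ℝ)) with hE
  set K := (m : ℝ) ^ 3 * (1 + Real.log m) * (Gf + γ * Gg) / (lam * √ε) with hK
  have hA0 : 0 ≤ A := by positivity
  have hB0 : 0 ≤ B := by positivity
  have hE0 : 0 ≤ E := by positivity
  have hK0 : 0 ≤ K := by positivity
  have hrate : checkRate m γ lam Lg Gf Gg ε = A + B + E + K := rfl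
  have e : (1 + Real.log m) * logTerm γ lam Lg Gf Gg ε
      * ((Gf + γ * Gg + γ * Lg) ^ 2 / (lam ^ 2 * ε)) = A * logTerm γ lam Lg Gf Gg ε := by
    rw [hA]; ring
  -- Using `m + 1 ≤ 2m`; the rounding of the first length costs a multiple of `m`, covered by the
  -- separate summand `m` of the bound.
  have h1 : (phaseLength₁ m γ lam Gf Gg ε : ℝ) * (m + 1) ≤ 16 * K + 4 * m := by
    calc (phaseLength₁ m γ lam Gf Gg ε : ℝ) * (m + 1)
        ≤ (8 * ((m : ℝ) ^ 2 * (Gf + γ * Gg) / (lam * √ε)) + 2) * (2 * m) := by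
          gcongr
          linarith
      _ = 16 * ((m : ℝ) ^ 3 * 1 * (Gf + γ * Gg) / (lam * √ε)) + 4 * m := by ring
      _ ≤ _ := by rw [hK]; gcongr
  rw [e] at hT₂
  rw [hrate, pow_one]
  push_cast
  nlinarith [mul_nonneg hB0 (sub_nonneg.2 hΛ), mul_nonneg hE0 (sub_nonneg.2 hΛ),
    mul_nonneg hK0 (sub_nonneg.2 hΛ), mul_nonneg (zero_le_one.trans hm1) (sub_nonneg.2 hΛ)]

end Positivity

end Rates

end MidTouch

theorem mainTheorem2 :
    ∃ (C : ℝ) (a : ℕ), 0 < C ∧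
      ∀ (m : ℕ) (γ lam Lg Gf Gg ε : ℝ),
        0 < m → 0 < γ → 0 < lam → 0 < Lg → 0 ≤ Gf → 0 ≤ Gg → 0 < ε →
        ∃ T₁ T₂ : ℕ, 0 < T₁ ∧ 0 < T₂ ∧
          (T₁ : ℝ) ≤ C * (1 + MidTouch.rate₁ m γ lam Lg Gf Gg ε)
            * MidTouch.logTerm γ lam Lg Gf Gg ε ^ a ∧
          (T₂ : ℝ) ≤ C * (1 + MidTouch.rate₂ m γ lam Lg Gf Gg ε)
            * MidTouch.logTerm γ lam Lg Gf Gg ε ^ a ∧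
          ∀ (d : ℕ) (P : MidTouch.Problem d m) (O : MidTouch.Oracle d m) (Lf rho : ℝ)
            (wstar : MidTouch.Vec d),
            P.Admissible lam Lf Lg rho → Lf / rho < γ → O.Valid P Gg → P.IsOptimum wstar →
            ∀ (H : MidTouch.Hyper),
              H = ⟨γ, lam, lam / (2 * γ ^ 2 * Lg ^ 2), T₁, T₂⟩ →
              (∀ D : MidTouch.Draws d m,
                (MidTouch.totalChecks P O H D : ℝ)
                  ≤ C * (m + MidTouch.checkRate m γ lam Lg Gf Gg ε)
                    * MidTouch.logTerm γ lam Lg Gf Gg ε ^ a) ∧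
              ∀ (Ω : Type*) (mΩ : MeasurableSpace Ω) (μ : MeasureTheory.Measure Ω)
                (F : MeasureTheory.Filtration ℕ mΩ) (D : Ω → MidTouch.Draws d m),
                MeasureTheory.IsProbabilityMeasure μ →
                MidTouch.IsRun μ F P O H Gf D →
                MeasureTheory.Integrable (fun ω =>
                  ‖MidTouch.proj P.feasible (MidTouch.average P O H (D ω)) - wstar‖ ^ 2) μ ∧
                MeasureTheory.Integrable (fun ω =>
                  ‖MidTouch.average P O H (D ω) - wstar‖ ^ 2) μ ∧
                ∫ ω, ‖MidTouch.proj P.feasible (MidTouch.average P O H (D ω)) - wstar‖ ^ 2 ∂μ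
                  ≤ ∫ ω, ‖MidTouch.average P O H (D ω) - wstar‖ ^ 2 ∂μ ∧
                ∫ ω, ‖MidTouch.average P O H (D ω) - wstar‖ ^ 2 ∂μ ≤ ε := by
  refine ⟨128, 1, by norm_num, fun m γ lam Lg Gf Gg ε hm hγ hlam hLg hGf hGg hε => ?_⟩
  refine ⟨MidTouch.phaseLength₁ m γ lam Gf Gg ε, MidTouch.phaseLength₂ m γ lam Lg Gf Gg ε,
    Nat.succ_pos _, Nat.succ_pos _, MidTouch.phaseLength₁_le_rate hm hγ hlam hLg hGf hGg hε,
    MidTouch.phaseLength₂_le_rate hm hγ hlam hLg hGf hGg hε, ?_⟩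
  intro d P O Lf rho wstar hP hLf hO hopt H hH
  have hchecks := MidTouch.checks_le_rate hm hγ hlam hLg hGf hGg hε
  have herror := fun s => MidTouch.error_le (s := s) hm hγ hlam hLg hGf hGg hε
  have hT₁ : H.T₁ = MidTouch.phaseLength₁ m γ lam Gf Gg ε := by rw [hH]
  have hT₂ : H.T₂ = MidTouch.phaseLength₂ m γ lam Lg Gf Gg ε := by rw [hH]
  have hη : H.η = lam / (2 * γ ^ 2 * Lg ^ 2) := by rw [hH]
  obtain rfl : γ = H.γ := by rw [hH]
  obtain rfl : lam = H.lam := by rw [hH]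
  have hT₁0 : 0 < H.T₁ := hT₁ ▸ Nat.succ_pos _
  have hT₂0 : 0 < H.T₂ := hT₂ ▸ Nat.succ_pos _
  rw [← hT₁, ← hT₂] at hchecks herror
  refine ⟨fun D => by rw [MidTouch.totalChecks_eq]; exact hchecks, ?_⟩
  intro Ω mΩ μ F D hμ hrun
  have : Nonempty (Fin m) := Fin.pos_iff_nonempty.1 hm
  obtain ⟨q, hq, hmult⟩ := hP.exists_multiplier hLf hγ hlam.le hopt
  have hs := hopt.1
  -- The `q`-average of the violations is at most the largest one, so the growth also holds for the
  -- penalty used in the first phase.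
  have hpen : ∀ w ∈ P.W, ∀ i, (∀ k, P.g k w ≤ P.g i w) →
      P.f wstar + H.lam / 2 * ‖w - wstar‖ ^ 2 ≤ P.f w + H.γ * P.gpos i w := by
    intro w hw i hi
    refine (hmult w hw).trans (add_le_add le_rfl (mul_le_mul_of_nonneg_left ?_ hγ.le))
    calc ∑ k, q k * P.gpos k w ≤ ∑ k, q k * P.gpos i w :=
          Finset.sum_le_sum fun k _ => mul_le_mul_of_nonneg_left (max_le_max le_rfl (hi k)) (hq.1 k)
      _ = P.gpos i w := by rw [← Finset.sum_mul, hq.2, one_mul]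
  have h1 := MidTouch.integral_firstAverage_le hrun hP hs hO hγ hlam hT₁0 hpen
  have h2 := MidTouch.sum_integral_secondPhase_le hrun hP hs hO hT₁0 hγ hlam hLg hη hq hmult
  have hmeas : Measurable fun ω => MidTouch.average P O H (D ω) :=
    MidTouch.measurable_sum_range (fun n hn =>
      ((MidTouch.measurable_secondPhase hrun hP hs hO hT₁0 hn.le).1).mono (F.le _) le_rfl) _
  have hmem : ∀ ω, MidTouch.average P O H (D ω) ∈ P.W := fun ω => MidTouch.average_mem hP
    (fun n => MidTouch.secondPhase_w_mem hP hs (hrun.init_mem ω) hT₁0 n) hT₂0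
  have hfne : P.feasible.Nonempty := ⟨_, hs⟩
  have hfcl := hP.isClosed_feasible
  have hfcv := hP.convex_feasible
  have hI₁ : Integrable (fun ω => ‖MidTouch.average P O H (D ω) - wstar‖ ^ 2) μ :=
    (MidTouch.bddMeas_norm_sub_sq hP hmeas hmem).integrable
  have hI₂ : Integrable (fun ω =>
      ‖MidTouch.proj P.feasible (MidTouch.average P O H (D ω)) - wstar‖ ^ 2) μ :=
    (MidTouch.bddMeas_norm_sub_sq hP ((MidTouch.continuous_proj hfne hfcl hfcv).measurable.comp
      hmeas) fun ω => (MidTouch.proj_spec hfne hfcl _).1.1).integrable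
  refine ⟨hI₂, hI₁, integral_mono hI₂ hI₁ fun ω => pow_le_pow_left₀ (norm_nonneg _)
    (MidTouch.norm_proj_sub_le hfne hfcl hfcv _ hs) 2, ?_⟩
  have hX : ∀ n ∈ Finset.range H.T₂,
      Integrable (fun ω => ‖(MidTouch.secondPhase P O H (D ω) n).val.w - wstar‖ ^ 2) μ :=
    fun n hn => (MidTouch.bddMeas_secondPhase hrun hP hs hO hT₁0
      (Finset.mem_range.1 hn).le).integrable
  have h3 : ∫ ω, ‖MidTouch.average P O H (D ω) - wstar‖ ^ 2 ∂μ
      ≤ 1 / (H.T₂ : ℝ) * ∑ n ∈ Finset.range H.T₂,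
        ∫ ω, ‖(MidTouch.secondPhase P O H (D ω) n).val.w - wstar‖ ^ 2 ∂μ := by
    rw [← integral_finsetSum _ hX, ← integral_const_mul]
    exact integral_mono hI₁ ((integrable_finsetSum _ hX).const_mul _)
      fun ω => MidTouch.norm_average_sub_sq_le hT₂0
  refine h3.trans (herror _ (h2.trans ?_))
  -- The bound on the starting distance of the second phase contributes the first `T₁` terms of the
  -- harmonic sum, and the second phase the following `T₂`.
  have h4 := mul_le_mul_of_nonneg_left (MidTouch.sum_one_div_le H.T₁ H.T₂)
    (by positivity : 0 ≤ (Gf + H.γ * Gg) ^ 2 / (2 * H.lam))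
  rw [mul_add] at h4
  linarith
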